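/- Let $n\ge 3$ and let $\mathfrak{sp}(n,\mathbb R)=\{M\in\mathfrak{gl}_{2n}(\mathbb R): M^TJ+JM=0\}$, where $J=\begin{bmatrix}0&I_n\\-I_n&0\end{bmatrix}$, acting on $\mathbb R^{2n}$ by matrix multiplication (the standard representation). Consider the finite-dimensional real representations $V$ of $\mathfrak{sp}(n,\mathbb R)$ that are non-trivial (some element acts by a non-zero operator) and preserve a non-degenerate symmetric bilinear form, i.e. there is a non-degenerate symmetric bilinear form $\langle\cdot,\cdot\rangle$ on $V$ with $\langle X v,w\rangle+\langle v,X w\rangle=0$ for all $X\in\mathfrak{sp}(n,\mathbb R)$ and $v,w\in V$. The minimal dimension of such a representation is $4n$ (in particular it is attained), and every such representation of dimension $4n$ is isomorphic, as an $\mathfrak{sp}(n,\mathbb R)$-module, to $\mathbb R^{2n}\oplus\mathbb R^{2n}$. -/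

import Mathlib

attribute [local instance 100] LieRing.ofAssociativeRing

open scoped DirectSum

universe u

/-- The real symplectic Lie algebra `𝔰𝔭(n, ℝ)` of `2n × 2n` real matrices, acting on column
vectors `Fin n ⊕ Fin n → ℝ` by matrix multiplication. -/
abbrev SpReal (n : ℕ) : LieSubalgebra ℝ (Matrix (Fin n ⊕ Fin n) (Fin n ⊕ Fin n) ℝ) :=
  LieAlgebra.Symplectic.sp (Fin n) ℝ

/-- `𝔰𝔭(n, ℝ)` consists of the `M` with `Mᵀ J + J M = 0` for `J = [[0, I], [-I, 0]]`. -/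
theorem mem_SpReal_iff (n : ℕ) (M : Matrix (Fin n ⊕ Fin n) (Fin n ⊕ Fin n) ℝ) :
    M ∈ SpReal n ↔
      M.transpose * Matrix.fromBlocks 0 1 (-1) 0 + Matrix.fromBlocks 0 1 (-1) 0 * M = 0 := by
  have hJ : (Matrix.fromBlocks 0 1 (-1) 0 : Matrix (Fin n ⊕ Fin n) (Fin n ⊕ Fin n) ℝ)
      = -Matrix.J (Fin n) ℝ := by
    simp [Matrix.J, Matrix.fromBlocks_neg]
  rw [hJ]
  change M ∈ skewAdjointMatricesLieSubalgebra (Matrix.J (Fin n) ℝ) ↔ _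
  rw [mem_skewAdjointMatricesLieSubalgebra, mem_skewAdjointMatricesSubmodule]
  simp only [Matrix.IsSkewAdjoint, Matrix.IsAdjointPair, Matrix.mul_neg, Matrix.neg_mul]
  constructor
  · intro h; rw [h]; simp
  · intro h
    have h2 := neg_eq_zero.mpr h
    rw [neg_add, neg_neg, neg_neg] at h2
    exact eq_neg_of_add_eq_zero_left h2

/-- The standard representation of `𝔰𝔭(n, ℝ)` on `ℝ²ⁿ`. -/
abbrev StdRep (n : ℕ) : Type := Fin n ⊕ Fin n → ℝ

/-- The real Lie module `V` carries a non-degenerate symmetric bilinear form `B` preserved by `L`,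
that is `B (x • v) w + B v (x • w) = 0` for `x` in `L`. -/
def PreservesNondegSymmForm (L V : Type*) [LieRing L] [LieAlgebra ℝ L] [AddCommGroup V]
    [Module ℝ V] [LieRingModule L V] [LieModule ℝ L V] : Prop :=
  ∃ B : LinearMap.BilinForm ℝ V, B.IsSymm ∧ B.Nondegenerate ∧
    ∀ (x : L) (v w : V), B ⁅x, v⁆ w + B v ⁅x, w⁆ = 0

/-! Let `dim V ≤ 4n`. Everything follows from embedding two copies of the standard representation
into any non-trivial `V` with an invariant non-degenerate symmetric form: counting dimensions gives
both the lower bound and the uniqueness. Complete reducibility and the highest weight classification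
are not used.

The weights of `V` (eigenvalues of actual joint eigenvectors) are closed under subtracting a root on
which they are positive, by `𝔰𝔩₂` theory, and there are at most `4n` of them. For `n ≥ 3` this
combinatorics leaves only `0` and `±e_i` (`eq_zero_or_stdWeight_of_stepClosed`): any other weight
generates too many.

The Cartan subalgebra is not known in advance to act diagonalisably. The long roots `2e_i` give
commuting `𝔰𝔩₂`-triples `(E_i, H_i, F_i)`. If `E_i E_j ≠ 0`, a maximal nonzero monomial in the `E`'s
divisible by it has an image consisting of vectors whose weight is the exponent vector, which is
neither `0` nor a unit vector. Hence `E_i E_j = 0` for all `i, j` (`long_mul_long`), and so `H_i³ =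
H_i` and `H_i H_j = 0` for `i ≠ j`: the Cartan subalgebra acts as it does on a sum of standard and
trivial modules.

Short products of generators now vanish for weight reasons. The normalised maps `transfer` between
the weight spaces of `±e_i` compose consistently (`transfer_transfer`), so each vector `w` of weight
`e_i` spans a copy of `ℝ²ⁿ`, and independent vectors give independent copies. Such a `w` exists
because the action is non-trivial. A second one exists because, with `f` the root vector for
`-2e_i`, the form `B(u, f u')` is alternating and non-degenerate on the weight space of `e_i`, whose
dimension is therefore even (`exists_linearIndependent_pair`). -/

/-- The weights `± e_i` of the standard representation, indexed by its basis. -/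
def stdWeight {n : ℕ} : Fin n ⊕ Fin n → (Fin n → ℤ) :=
  Sum.elim (fun i => Pi.single i 1) (fun i => Pi.single i (-1))

/-- The pairing of an integral weight with the coroot of the long root `2 • stdWeight c`. -/
def coordOf {n : ℕ} (l : Fin n → ℤ) : Fin n ⊕ Fin n → ℤ := Sum.elim l (-l)

/-! ### Combinatorics of small sets of weights of type C. -/

section Weights

variable {n : ℕ}

@[simp] theorem coordOf_swap (l : Fin n → ℤ) (c : Fin n ⊕ Fin n) :
    coordOf l c.swap = -coordOf l c := by
  cases c <;> simp [coordOf]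

@[simp] theorem coordOf_add (l m : Fin n → ℤ) (c : Fin n ⊕ Fin n) :
    coordOf (l + m) c = coordOf l c + coordOf m c := by
  cases c <;> simp [coordOf]; ring

@[simp] theorem coordOf_sub (l m : Fin n → ℤ) (c : Fin n ⊕ Fin n) :
    coordOf (l - m) c = coordOf l c - coordOf m c := by
  cases c <;> simp [coordOf]; ring

@[simp] theorem coordOf_neg (l : Fin n → ℤ) (c : Fin n ⊕ Fin n) :
    coordOf (-l) c = -coordOf l c := by
  cases c <;> simp [coordOf]

@[simp] theorem coordOf_zero (c : Fin n ⊕ Fin n) : coordOf (0 : Fin n → ℤ) c = 0 := by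
  cases c <;> simp [coordOf]

theorem coordOf_stdWeight (c d : Fin n ⊕ Fin n) :
    coordOf (stdWeight c) d = if c = d then 1 else if c = d.swap then -1 else 0 := by
  rcases c with c | c <;> rcases d with d | d <;>
    simp [coordOf, stdWeight, Pi.single_apply, eq_comm] <;> split_ifs <;> simp

theorem stdWeight_swap (c : Fin n ⊕ Fin n) : stdWeight c.swap = -stdWeight c := by
  funext i
  rcases c with c | c <;> simp [stdWeight, Pi.single_apply] <;> split_ifs <;> simp

theorem coordOf_ext {l m : Fin n → ℤ} (h : ∀ c, coordOf l c = coordOf m c) : l = m := by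
  funext i; exact h (Sum.inl i)

theorem sum_swap_ne (c : Fin n ⊕ Fin n) : c.swap ≠ c := by
  rcases c with c | c <;> simp [Sum.swap]

theorem dotProduct_stdWeight (l : Fin n → ℤ) (c : Fin n ⊕ Fin n) :
    l ⬝ᵥ stdWeight c = coordOf l c := by
  cases c <;> simp [stdWeight, coordOf]

theorem stdWeight_injective : Function.Injective (stdWeight (n := n)) := by
  intro a b h
  have h1 := coordOf_stdWeight a b
  rw [h, coordOf_stdWeight] at h1
  by_contra hne
  rw [if_pos rfl, if_neg hne] at h1
  split_ifs at h1
  all_goals omega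

/-- `S` is closed under subtracting a root on which the weight is positive. -/
def StepClosed (S : Set (Fin n → ℤ)) : Prop :=
  ∀ l ∈ S, ∀ c d : Fin n ⊕ Fin n, c ≠ d.swap → 0 < coordOf l c + coordOf l d →
    l - stdWeight c - stdWeight d ∈ S

namespace StepClosed

variable {S : Set (Fin n → ℤ)} (hS : StepClosed S)
include hS

theorem sub_add {l : Fin n → ℤ} (hl : l ∈ S) {c e : Fin n ⊕ Fin n} (hce : c ≠ e)
    (h : coordOf l e < coordOf l c) : l - stdWeight c + stdWeight e ∈ S := by
  have := hS l hl c e.swap (by simpa using hce) (by simpa using h)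
  rwa [stdWeight_swap, sub_neg_eq_add] at this

theorem stdWeight_mem {a : Fin n ⊕ Fin n} (ha : stdWeight a ∈ S) (b : Fin n ⊕ Fin n) :
    stdWeight b ∈ S := by
  by_cases h : a = b
  · rwa [← h]
  · have := hS.sub_add ha h (by
      simp only [coordOf_stdWeight, if_true, h, if_false]; split_ifs <;> simp)
    simpa using this

theorem pair_move {a b e : Fin n ⊕ Fin n} (h : stdWeight a + stdWeight b ∈ S)
    (hab : a ≠ b) (hab' : a ≠ b.swap) (heb : e ≠ b) (heb' : e ≠ b.swap) :
    stdWeight e + stdWeight b ∈ S := by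
  by_cases hae : a = e
  · rwa [← hae]
  have := hS.sub_add h hae (by
    have h1 : b ≠ a := hab.symm
    have h2 : b ≠ a.swap := fun h => hab' (by simp [h])
    have h3 : b ≠ e := heb.symm
    have h4 : b ≠ e.swap := fun h => heb' (by simp [h])
    simp only [coordOf_add, coordOf_stdWeight, if_true, hae, h1, h2, h3, h4, if_false]
    split_ifs <;> simp)
  convert this using 1
  abel

theorem triple_move {a b c e : Fin n ⊕ Fin n} (h : stdWeight a + stdWeight b + stdWeight c ∈ S)
    (hab : a ≠ b) (hab' : a ≠ b.swap) (hac : a ≠ c) (hac' : a ≠ c.swap)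
    (heb : e ≠ b) (heb' : e ≠ b.swap) (hec : e ≠ c) (hec' : e ≠ c.swap) :
    stdWeight e + stdWeight b + stdWeight c ∈ S := by
  by_cases hae : a = e
  · rwa [← hae]
  have := hS.sub_add h hae (by
    have h1 : b ≠ a := hab.symm
    have h2 : b ≠ a.swap := fun h => hab' (by simp [h])
    have h3 : b ≠ e := heb.symm
    have h4 : b ≠ e.swap := fun h => heb' (by simp [h])
    have h5 : c ≠ a := hac.symm
    have h6 : c ≠ a.swap := fun h => hac' (by simp [h])
    have h7 : c ≠ e := hec.symm
    have h8 : c ≠ e.swap := fun h => hec' (by simp [h])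
    simp only [coordOf_add, coordOf_stdWeight, if_true, hae, h1, h2, h3, h4, h5, h6, h7, h8,
      if_false]
    split_ifs <;> simp)
  convert this using 1
  abel

end StepClosed

theorem exists_not_mem_pair (hn : 3 ≤ n) (a b : Fin n ⊕ Fin n) :
    ∃ k : Fin n ⊕ Fin n, k ≠ a ∧ k ≠ a.swap ∧ k ≠ b ∧ k ≠ b.swap := by
  have h : ({a, a.swap, b, b.swap} : Finset (Fin n ⊕ Fin n)).card <
      (Finset.univ : Finset (Fin n ⊕ Fin n)).card := by
    have := Finset.card_le_four (a := a) (b := a.swap) (c := b) (d := b.swap)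
    simp only [Finset.card_univ, Fintype.card_sum, Fintype.card_fin]
    omega
  obtain ⟨k, -, hk⟩ := Finset.exists_mem_notMem_of_card_lt_card h
  simp only [Finset.mem_insert, Finset.mem_singleton, not_or] at hk
  exact ⟨k, hk⟩

/-- The entries are replaced one at a time; a third index `k` avoiding `b` and `d` up to sign,
available since `4 < 2n`, keeps the two entries from interfering. -/
theorem StepClosed.pair_mem (hn : 3 ≤ n) {S : Set (Fin n → ℤ)} (hS : StepClosed S)
    {a b : Fin n ⊕ Fin n} (h : stdWeight a + stdWeight b ∈ S) (hab : a ≠ b) (hab' : a ≠ b.swap)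
    {c d : Fin n ⊕ Fin n} (hcd : c ≠ d) (hcd' : c ≠ d.swap) :
    stdWeight c + stdWeight d ∈ S := by
  obtain ⟨k, k1, k2, k3, k4⟩ := exists_not_mem_pair hn b d
  have h1 := hS.pair_move h hab hab' k1 k2
  rw [add_comm] at h1
  have h2 := hS.pair_move (e := d) h1 k1.symm (fun h => k2 (by simp [h])) k3.symm
    (fun h => k4 (by simp [h]))
  rw [add_comm] at h2
  exact hS.pair_move h2 k3 k4 hcd hcd'

/-- The vector of `Fin n ⊕ Fin n` with given index and sign. -/
def signedIndex (i : Fin n) (s : Bool) : Fin n ⊕ Fin n := if s then Sum.inl i else Sum.inr i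

/-- One short root produces all of them and `0`. The `4n` vectors `±e_i ± e_{i+1}`, with indices
modulo `n`, are distinct for `n ≥ 3`, and together with `0` they exceed the bound by one. -/
theorem card_of_pair_mem (hn : 3 ≤ n) {S : Set (Fin n → ℤ)} (hS : StepClosed S)
    (hcard : ∀ F : Finset (Fin n → ℤ), ↑F ⊆ S → F.card ≤ 4 * n)
    {a b : Fin n ⊕ Fin n} (h : stdWeight a + stdWeight b ∈ S) (hab : a ≠ b)
    (hab' : a ≠ b.swap) : False := by
  have : NeZero n := ⟨by omega⟩
  have hsucc : ∀ i : Fin n, i ≠ i + 1 ∧ i + 1 + 1 ≠ i := by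
    intro i
    have h1 : (1 : Fin n).val = 1 := by
      rw [Fin.val_one']; exact Nat.mod_eq_of_lt (by omega)
    constructor
    · intro h
      have h0 : (1 : Fin n) = 0 := by simpa using h.symm
      rw [h0] at h1; simp at h1
    · intro h
      have h0 : (1 + 1 : Fin n) = 0 := by simpa [add_assoc] using h
      have := congrArg Fin.val h0
      rw [Fin.val_add, h1, Nat.mod_eq_of_lt (by omega)] at this
      simp at this
  let f : Option (Fin n × Bool × Bool) → (Fin n → ℤ) := fun o => o.elim 0 fun p =>
    stdWeight (signedIndex p.1 p.2.1) + stdWeight (signedIndex (p.1 + 1) p.2.2)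
  have hval : ∀ i s t j, f (some (i, s, t)) j = (if j = i then (if s then 1 else -1) else 0) +
      (if j = i + 1 then (if t then 1 else -1) else 0) := by
    intro i s t j
    cases s <;> cases t <;> simp [f, signedIndex, stdWeight, Pi.single_apply]
  have hne : ∀ (i : Fin n) s t, f (some (i, s, t)) ≠ 0 := by
    intro i s t h
    have := congrFun h i
    rw [hval] at this
    simp only [if_true, (hsucc i).1, if_false] at this
    cases s <;> simp at this
  have hinj : Function.Injective f := by
    rintro (_ | ⟨i, s, t⟩) (_ | ⟨j, s', t'⟩) h
    · rfl
    · exact absurd h.symm (hne _ _ _)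
    · exact absurd h (hne _ _ _)
    · have e1 := congrFun h i
      have e2 := congrFun h (i + 1)
      rw [hval, hval] at e1 e2
      have hi := hsucc i
      have hj := hsucc j
      have key : i = j := by
        by_contra hij
        have hij' : i = j + 1 := by
          by_contra h'
          simp only [if_true, hi.1, hij, h', if_false] at e1
          cases s <;> simp at e1
        have h2 : i + 1 ≠ j := fun h => hj.2 (by rw [← hij']; exact h)
        have h3 : i + 1 ≠ j + 1 := fun h => hij (by simpa using h)
        simp only [if_true, hi.1.symm, h2, h3, if_false] at e2
        cases t <;> simp at e2
      subst key
      simp only [if_true, hi.1, hi.1.symm, if_false] at e1 e2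
      cases s <;> cases s' <;> cases t <;> cases t' <;> simp at e1 e2 <;> rfl
  have hmem : ∀ o, f o ∈ S := by
    rintro (_ | ⟨i, s, t⟩)
    · have := hS _ h a b hab' (by
        simp only [coordOf_add, coordOf_stdWeight, if_true]
        have : b ≠ a.swap := fun h => hab' (by simp [h])
        simp [hab, hab', hab.symm, this])
      simpa [f] using this
    · refine hS.pair_mem hn h hab hab' ?_ ?_ <;>
      · have := (hsucc i).1
        cases s <;> cases t <;> simp [signedIndex, this]
  have := hcard (Finset.univ.map ⟨f, hinj⟩) (by
    intro x hx
    simp only [Finset.coe_map, Function.Embedding.coeFn_mk, Finset.coe_univ, Set.image_univ,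
      Set.mem_range] at hx
    obtain ⟨o, rfl⟩ := hx
    exact hmem o)
  simp at this
  omega

/-- The set contains all `2n` vectors `±e_i` and the vectors `±a ± b + e` with `e` off `±a, ±b`,
hence at least `2n + 4(2n - 4) = 10n - 16` elements, more than `4n` once `n ≥ 3`. -/
theorem card_of_triple_mem (hn : 3 ≤ n) {S : Set (Fin n → ℤ)} (hS : StepClosed S)
    (hcard : ∀ F : Finset (Fin n → ℤ), ↑F ⊆ S → F.card ≤ 4 * n)
    {a b c : Fin n ⊕ Fin n} (h : stdWeight a + stdWeight b + stdWeight c ∈ S) (hab : a ≠ b)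
    (hab' : a ≠ b.swap) (hac : a ≠ c) (hac' : a ≠ c.swap) (hbc : b ≠ c) (hbc' : b ≠ c.swap) :
    False := by
  have hs : ∀ {x y : Fin n ⊕ Fin n}, x ≠ y.swap → y ≠ x.swap := fun h h' => h (by simp [h'])
  have hs' : ∀ {x y : Fin n ⊕ Fin n}, x ≠ y → x.swap ≠ y.swap := fun h h' =>
    h (by simpa using congrArg Sum.swap h')
  let sg : Bool → (Fin n ⊕ Fin n) → (Fin n ⊕ Fin n) := fun s x => if s then x else x.swap
  let K := {e : Fin n ⊕ Fin n // e ∉ ({a, a.swap, b, b.swap} : Finset (Fin n ⊕ Fin n))}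
  have hK : 2 * n - 4 ≤ Fintype.card K := by
    have h1 := Finset.le_card_sdiff ({a, a.swap, b, b.swap} : Finset (Fin n ⊕ Fin n)) Finset.univ
    have := Finset.card_le_four (a := a) (b := a.swap) (c := b) (d := b.swap)
    have h2 : Fintype.card K =
        (Finset.univ \ ({a, a.swap, b, b.swap} : Finset (Fin n ⊕ Fin n))).card := by
      rw [Fintype.card_subtype]; congr 1; ext x; simp
    rw [h2]
    simp only [Finset.card_univ, Fintype.card_sum, Fintype.card_fin] at h1
    omega
  let f : (Fin n ⊕ Fin n) ⊕ (Bool × Bool × K) → (Fin n → ℤ) :=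
    Sum.elim stdWeight fun p => stdWeight (sg p.1 a) + stdWeight (sg p.2.1 b) + stdWeight p.2.2.1
  have hsg : ∀ s x, sg s x = x ∨ sg s x = x.swap := by intro s x; cases s <;> simp [sg]
  have hKne : ∀ e : K, e.1 ≠ a ∧ e.1 ≠ a.swap ∧ e.1 ≠ b ∧ e.1 ≠ b.swap := by
    intro e; simpa [not_or] using e.2
  have hca : ∀ s t e, coordOf (f (Sum.inr (s, t, e))) a = if s then 1 else -1 := by
    intro s t e
    have he := hKne e
    cases s <;> cases t <;>
      simp [f, sg, coordOf_stdWeight, he, hab.symm, hs hab', hs' hab.symm, sum_swap_ne,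
        hab'.symm]
  have hcb : ∀ s t e, coordOf (f (Sum.inr (s, t, e))) b = if t then 1 else -1 := by
    intro s t e
    have he := hKne e
    cases s <;> cases t <;>
      simp [f, sg, coordOf_stdWeight, he, hab, hab', hs' hab, sum_swap_ne,
        (hs hab').symm]
  have hinj : Function.Injective f := by
    have hdisj : ∀ x p, f (Sum.inl x) ≠ f (Sum.inr p) := by
      rintro x ⟨s, t, e⟩ h
      have e1 := hca s t e
      have e2 := hcb s t e
      rw [← h] at e1 e2
      simp only [f, Sum.elim_inl, coordOf_stdWeight] at e1 e2
      have hx : x = a ∨ x = a.swap := by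
        by_contra hx
        rw [not_or] at hx
        simp only [hx.1, hx.2, if_false] at e1
        cases s <;> simp at e1
      have hx1 : x ≠ b := by rcases hx with rfl | rfl; exacts [hab, (hs hab').symm]
      have hx2 : x ≠ b.swap := by rcases hx with rfl | rfl; exacts [hab', hs' hab]
      simp only [hx1, hx2, if_false] at e2
      cases t <;> simp at e2
    rintro (x | ⟨s, t, e⟩) (y | ⟨s', t', e'⟩) h
    · exact congrArg _ (stdWeight_injective h)
    · exact absurd h (hdisj _ _)
    · exact absurd h.symm (hdisj _ _)
    · have e1 := hca s t e
      rw [h, hca] at e1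
      have e2 := hcb s t e
      rw [h, hcb] at e2
      have hss : s = s' := by cases s <;> cases s' <;> simp at e1 <;> rfl
      have htt : t = t' := by cases t <;> cases t' <;> simp at e2 <;> rfl
      subst hss htt
      have := stdWeight_injective (add_left_cancel (h : _ + _ = _ + _))
      obtain rfl : e = e' := Subtype.ext this
      rfl
  have hmem : ∀ o, f o ∈ S := by
    have hsgne : ∀ s x y, x ≠ y → x ≠ y.swap → sg s x ≠ y ∧ sg s x ≠ y.swap := by
      intro s x y h1 h2
      rcases hsg s x with h | h <;> rw [h]
      exacts [⟨h1, h2⟩, ⟨(hs h2).symm, hs' h1⟩]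
    rintro (x | ⟨s, t, e⟩)
    · have := hS _ h a b hab' (by
        simp [coordOf_stdWeight, hab, hab', hab.symm, hs hab', hac.symm, hbc.symm, hs hac',
          hs hbc'])
      have h' : stdWeight c ∈ S := by convert this using 1; abel
      exact hS.stdWeight_mem h' x
    · obtain ⟨a1, a2⟩ := hsgne s a b hab hab'
      obtain ⟨a3, a4⟩ := hsgne s a c hac hac'
      obtain ⟨b3, b4⟩ := hsgne t b c hbc hbc'
      obtain ⟨b1, b2⟩ := hsgne t b (sg s a) a1.symm (hs a2)
      have m1 := hS.triple_move (e := sg s a) h hab hab' hac hac' a1 a2 a3 a4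
      have m2 : stdWeight b + stdWeight (sg s a) + stdWeight c ∈ S := by
        rwa [add_comm (stdWeight b)]
      have m3 := hS.triple_move (e := sg t b) m2 a1.symm (hs a2) hbc hbc' b1 b2 b3 b4
      have m4 : stdWeight c + stdWeight (sg s a) + stdWeight (sg t b) ∈ S := by
        convert m3 using 1; abel
      obtain ⟨k1, k2, k3, k4⟩ := hKne e
      obtain ⟨c1, c2⟩ := hsgne s a e k1.symm (hs k2)
      obtain ⟨c3, c4⟩ := hsgne t b e k3.symm (hs k4)
      have m5 := hS.triple_move (e := e.1) m4 a3.symm (hs a4) b3.symm (hs b4) c1.symm (hs c2)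
        c3.symm (hs c4)
      convert m5 using 1
      simp only [f, Sum.elim_inr]; abel
  have := hcard (Finset.univ.map ⟨f, hinj⟩) (by
    intro x hx
    simp only [Finset.coe_map, Function.Embedding.coeFn_mk, Finset.coe_univ, Set.image_univ,
      Set.mem_range] at hx
    obtain ⟨o, rfl⟩ := hx
    exact hmem o)
  simp at this
  omega

theorem dotProduct_step (l : Fin n → ℤ) (c d : Fin n ⊕ Fin n) :
    (l - stdWeight c - stdWeight d) ⬝ᵥ (l - stdWeight c - stdWeight d) =
      l ⬝ᵥ l - 2 * (coordOf l c + coordOf l d) + 2 + 2 * coordOf (stdWeight c) d := by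
  have h1 : stdWeight c ⬝ᵥ l = coordOf l c := by rw [dotProduct_comm, dotProduct_stdWeight]
  have h2 : stdWeight d ⬝ᵥ l = coordOf l d := by rw [dotProduct_comm, dotProduct_stdWeight]
  have h3 : stdWeight d ⬝ᵥ stdWeight c = coordOf (stdWeight c) d := by
    rw [dotProduct_comm, dotProduct_stdWeight]
  simp only [sub_dotProduct, dotProduct_sub, dotProduct_stdWeight, h1, h2]
  rw [← dotProduct_stdWeight (stdWeight d) c, h3]
  simp only [coordOf_stdWeight, if_true]
  ring

theorem eq_zero_or_stdWeight_of_stepClosed (hn : 3 ≤ n) {S : Set (Fin n → ℤ)}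
    (hS : StepClosed S) (hcard : ∀ F : Finset (Fin n → ℤ), ↑F ⊆ S → F.card ≤ 4 * n)
    {l : Fin n → ℤ} (hl : l ∈ S) : l = 0 ∨ ∃ c, l = stdWeight c := by
  have hs : ∀ {x y : Fin n ⊕ Fin n}, x ≠ y.swap → y ≠ x.swap := fun h h' => h (by simp [h'])
  induction hN : (l ⬝ᵥ l).toNat using Nat.strong_induction_on generalizing l with
  | _ N ih =>
  -- Subtracting a root `r` changes `|l|²` by `|r|² - 2⟨l, r⟩`, and `|r|² = 2 + 2 * coordOf
  -- (stdWeight c) d`. The hypothesis says exactly that the norm drops, so induction applies to `l -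
  -- r`.
  have hstep : ∀ c d : Fin n ⊕ Fin n, c ≠ d.swap →
      1 + coordOf (stdWeight c) d < coordOf l c + coordOf l d →
      l - stdWeight c - stdWeight d = 0 ∨ ∃ e, l - stdWeight c - stdWeight d = stdWeight e := by
    intro c d hcd h
    have hpos : 0 ≤ (l - stdWeight c - stdWeight d) ⬝ᵥ (l - stdWeight c - stdWeight d) :=
      Finset.sum_nonneg fun i _ => mul_self_nonneg _
    have hcd1 : 0 ≤ coordOf (stdWeight c) d := by
      rw [coordOf_stdWeight]; split_ifs <;> simp
    have hds := dotProduct_step l c d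
    refine ih _ ?_ (hS l hl c d hcd (by omega)) rfl
    omega
  have hle : ∀ c, coordOf l c ≤ 1 := by
    intro c
    by_contra hc
    push Not at hc
    have h1 := hstep c c (sum_swap_ne c).symm (by
      simp only [coordOf_stdWeight, if_true]; omega)
    have key : l = stdWeight c + stdWeight c ∨
        ∃ a, a ≠ c.swap ∧ l = stdWeight c + stdWeight c + stdWeight a := by
      rcases h1 with h1 | ⟨a, h1⟩
      · left; rw [sub_sub, sub_eq_zero] at h1; exact h1
      · right
        refine ⟨a, ?_, ?_⟩
        · rintro rfl
          have h2 := congrArg (coordOf · c) h1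
          simp [coordOf_stdWeight, sum_swap_ne] at h2
          omega
        · rw [← h1]; abel
    -- Subtracting the root `e_c - e_d` from a weight with coordinate at least `2` at `c` and `0` at
    -- `d` gives a shorter weight with two positive coordinates, which induction excludes.
    have hbad : ∀ d, d ≠ c → d ≠ c.swap → coordOf l d = 0 → False := by
      intro d hd hd' h0
      have hcds : c ≠ d.swap := hs hd'
      have h2 := hstep c d.swap (by simpa using hd.symm) (by
        rw [coordOf_stdWeight]; simp [hd.symm, hcds, h0]; omega)
      have e1 : coordOf (l - stdWeight c - stdWeight d.swap) c ≥ 1 := by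
        simp [coordOf_stdWeight, stdWeight_swap, hd, hd']
        omega
      have e2 : coordOf (l - stdWeight c - stdWeight d.swap) d = 1 := by
        simp [coordOf_stdWeight, hcds, hd.symm, h0, sum_swap_ne]
      rcases h2 with h2 | ⟨e, h2⟩
      · rw [h2] at e2; simp at e2
      · rw [h2] at e1 e2
        rw [coordOf_stdWeight] at e1 e2
        have : e = d := by
          by_contra hne
          simp only [hne, if_false] at e2
          split_ifs at e2
          simp at e2
        subst this
        simp [hd, hd'] at e1
    rcases key with h | ⟨a, ha, h⟩
    · obtain ⟨d, d1, d2, -, -⟩ := exists_not_mem_pair hn c c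
      refine hbad d d1 d2 ?_
      rw [h]; simp [coordOf_stdWeight, d1.symm, hs d2]
    · obtain ⟨d, d1, d2, d3, d4⟩ := exists_not_mem_pair hn c a
      refine hbad d d1 d2 ?_
      rw [h]; simp [coordOf_stdWeight, d1.symm, hs d2, d3.symm, hs d4]
  by_contra hbad
  rw [not_or] at hbad
  obtain ⟨c, hc⟩ : ∃ c, coordOf l c = 1 := by
    by_contra hno
    push Not at hno
    refine hbad.1 (coordOf_ext fun c => ?_)
    have h1 := hle c
    have h2 := hle c.swap
    have h3 := hno c
    have h4 := hno c.swap
    simp only [coordOf_swap, coordOf_zero] at *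
    omega
  obtain ⟨d, hd, hdc⟩ : ∃ d, coordOf l d = 1 ∧ d ≠ c := by
    by_contra hno
    push Not at hno
    refine hbad.2 ⟨c, coordOf_ext fun d => ?_⟩
    rw [coordOf_stdWeight]
    split_ifs with h1 h2
    · rw [← h1, hc]
    · rw [show d = c.swap by simp [h2], coordOf_swap, hc]
    · have a1 := hle d
      have a2 := hle d.swap
      have a3 : coordOf l d ≠ 1 := fun h => h1 (hno d h).symm
      have a4 : coordOf l d.swap ≠ 1 := fun h => h2 (hno _ h).symm
      simp only [coordOf_swap] at a2 a4
      omega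
  have hdc' : d ≠ c.swap := by
    rintro rfl
    rw [coordOf_swap, hc] at hd; omega
  rcases hstep d c hdc' (by simp [coordOf_stdWeight, hdc, hdc', hc, hd]) with h | ⟨e, h⟩
  · rw [sub_sub, sub_eq_zero] at h
    exact card_of_pair_mem hn hS hcard (h ▸ hl) hdc hdc'
  · have hl' : l = stdWeight d + stdWeight c + stdWeight e := by rw [← h]; abel
    have ne1 : ∀ x, coordOf l x = 1 → coordOf (stdWeight d + stdWeight c) x = 1 →
        x ≠ e ∧ x ≠ e.swap := by
      intro x hx hx'
      rw [hl', coordOf_add, hx', coordOf_stdWeight] at hx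
      constructor
      · rintro rfl; simp at hx
      · rintro rfl; simp at hx; split_ifs at hx; omega
    obtain ⟨d1, d2⟩ := ne1 d hd (by simp [coordOf_stdWeight, hdc.symm, hs hdc'])
    obtain ⟨c1, c2⟩ := ne1 c hc (by simp [coordOf_stdWeight, hdc, hdc'])
    exact card_of_triple_mem hn hS hcard (hl' ▸ hl) hdc hdc' d1 d2 c1 c2

end Weights

/-! ### The model `𝔰𝔭(n, ℝ) ≃ Sym² ℝ²ⁿ` and its generators. -/

section Generators

variable {n : ℕ}

/-- The sign of a basis vector of `ℝ²ⁿ`. -/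
def sympSign : Fin n ⊕ Fin n → ℝ := Sum.elim (fun _ => 1) (fun _ => -1)

/-- The standard symplectic form on pairs of basis vectors. -/
def sympForm (a b : Fin n ⊕ Fin n) : ℝ := if b = a.swap then sympSign a else 0

theorem sympSign_swap (a : Fin n ⊕ Fin n) : sympSign a.swap = -sympSign a := by
  cases a <;> simp [sympSign]

theorem sympSign_mul_self (a : Fin n ⊕ Fin n) : sympSign a * sympSign a = 1 := by
  cases a <;> simp [sympSign]

theorem sympSign_eq (a : Fin n ⊕ Fin n) : sympSign a = 1 ∨ sympSign a = -1 := by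
  cases a <;> simp [sympSign]

theorem sympForm_swap (a b : Fin n ⊕ Fin n) : sympForm a b = -sympForm b a := by
  unfold sympForm
  by_cases h : b = a.swap
  · subst h; simp [sympSign_swap]
  · have h' : a ≠ b.swap := fun h' => h (by simp [h'])
    simp [h, h']

/-- The row vector `⟨b, ·⟩` for the symplectic form. -/
def sympRow (b : Fin n ⊕ Fin n) : Fin n ⊕ Fin n → ℝ := Pi.single b.swap (sympSign b)

theorem sympRow_dotProduct (b c : Fin n ⊕ Fin n) :
    sympRow b ⬝ᵥ (Pi.single c 1) = sympForm b c := by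
  simp [sympRow, sympForm, Pi.single_apply]

/-- The product `a b` in `Sym² ℝ²ⁿ ≃ 𝔰𝔭(n, ℝ)`, acting by `v ↦ ⟨b, v⟩ a + ⟨a, v⟩ b`. -/
def spGenMatrix (a b : Fin n ⊕ Fin n) : Matrix (Fin n ⊕ Fin n) (Fin n ⊕ Fin n) ℝ :=
  Matrix.vecMulVec (Pi.single a 1) (sympRow b) + Matrix.vecMulVec (Pi.single b 1) (sympRow a)

theorem spGenMatrix_apply (a b i j : Fin n ⊕ Fin n) :
    spGenMatrix a b i j = (if i = a then sympForm b j else 0) +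
      (if i = b then sympForm a j else 0) := by
  simp only [spGenMatrix, Matrix.add_apply, Matrix.vecMulVec_apply, sympRow, Pi.single_apply,
    sympForm]
  split_ifs <;> simp

theorem spGenMatrix_comm (a b : Fin n ⊕ Fin n) : spGenMatrix a b = spGenMatrix b a :=
  add_comm _ _

theorem spGenMatrix_lie (a b c d : Fin n ⊕ Fin n) :
    spGenMatrix a b * spGenMatrix c d - spGenMatrix c d * spGenMatrix a b =
      sympForm b c • spGenMatrix a d + sympForm a c • spGenMatrix b d +
      sympForm b d • spGenMatrix a c + sympForm a d • spGenMatrix b c := by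
  simp only [spGenMatrix, mul_add, add_mul, Matrix.vecMulVec_mul_vecMulVec, sympRow_dotProduct,
    Matrix.vecMulVec_smul]
  rw [sympForm_swap d a, sympForm_swap d b, sympForm_swap c a, sympForm_swap c b]
  module

/-- Composing with the symplectic form turns the defining condition into symmetry of a matrix, which
is the identification with `Sym²`. -/
theorem mem_SpReal_iff_entries (M : Matrix (Fin n ⊕ Fin n) (Fin n ⊕ Fin n) ℝ) :
    M ∈ SpReal n ↔ ∀ a b, M a b.swap * sympSign b = M b a.swap * sympSign a := by
  rw [mem_SpReal_iff, ← Matrix.fromBlocks_toBlocks M]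
  generalize M.toBlocks₁₁ = A
  generalize M.toBlocks₁₂ = B
  generalize M.toBlocks₂₁ = C
  generalize M.toBlocks₂₂ = D
  simp only [Matrix.fromBlocks_transpose, Matrix.fromBlocks_multiply, Matrix.fromBlocks_add]
  rw [← Matrix.fromBlocks_zero, Matrix.fromBlocks_inj]
  simp only [← Matrix.ext_iff]
  simp only [mul_zero, zero_mul, mul_neg, mul_one, zero_add, add_zero, neg_mul, one_mul,
    Matrix.add_apply, Matrix.neg_apply, Matrix.transpose_apply, Matrix.zero_apply, Sum.forall,
    Sum.swap_inl, Sum.swap_inr, Matrix.fromBlocks_apply₁₁, Matrix.fromBlocks_apply₁₂,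
    Matrix.fromBlocks_apply₂₁, Matrix.fromBlocks_apply₂₂, sympSign, Sum.elim_inl, Sum.elim_inr]
  constructor
  · rintro ⟨h1, h2, h3, h4⟩
    refine ⟨fun a => ⟨fun b => ?_, fun b => ?_⟩, fun a => ⟨fun b => ?_, fun b => ?_⟩⟩
    · linarith [h4 a b]
    · linarith [h2 b a]
    · linarith [h2 a b]
    · linarith [h1 a b]
  · rintro h
    refine ⟨fun a b => ?_, fun a b => ?_, fun a b => ?_, fun a b => ?_⟩
    · linarith [(h.2 a).2 b]
    · linarith [(h.2 a).1 b]
    · linarith [(h.1 a).2 b]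
    · linarith [(h.1 a).1 b]

theorem spGenMatrix_mem (a b : Fin n ⊕ Fin n) : spGenMatrix a b ∈ SpReal n := by
  rw [mem_SpReal_iff_entries]
  intro i j
  have hs : ∀ c d : Fin n ⊕ Fin n, sympForm c d.swap * sympSign d = if d = c then 1 else 0 := by
    intro c d
    unfold sympForm
    by_cases h : d = c
    · subst h; simp [sympSign_mul_self]
    · have : d.swap ≠ c.swap := fun h' => h (by simpa using congrArg Sum.swap h')
      simp [h, this]
  simp only [spGenMatrix_apply, add_mul, ite_mul, hs, zero_mul]
  split_ifs <;> simp

/-- The product `a b` in `Sym² ℝ²ⁿ ≃ 𝔰𝔭(n, ℝ)`, as an element of `𝔰𝔭(n, ℝ)`. -/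
def spGen (a b : Fin n ⊕ Fin n) : SpReal n := ⟨spGenMatrix a b, spGenMatrix_mem a b⟩

theorem spGen_comm (a b : Fin n ⊕ Fin n) : spGen a b = spGen b a :=
  Subtype.ext (spGenMatrix_comm a b)

theorem spGen_lie (a b c d : Fin n ⊕ Fin n) :
    ⁅spGen a b, spGen c d⁆ = sympForm b c • spGen a d + sympForm a c • spGen b d +
      sympForm b d • spGen a c + sympForm a d • spGen b c := by
  apply Subtype.ext
  simpa [spGen, LieRing.of_associative_ring_bracket] using spGenMatrix_lie a b c d

-- The factor `1 / 2` appears because the sum runs over ordered pairs and `spGen a a` is already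
-- twice a rank-one matrix.
theorem eq_sum_spGen (x : SpReal n) :
    x = ∑ a, ∑ b, ((1 / 2 : ℝ) * (x.1 a b.swap * sympSign b)) • spGen a b := by
  apply Subtype.ext
  have hx := (mem_SpReal_iff_entries x.1).1 x.2
  ext i j
  have h1 : ((∑ a, ∑ b, ((1 / 2 : ℝ) * (x.1 a b.swap * sympSign b)) • spGen a b :
      SpReal n) : Matrix (Fin n ⊕ Fin n) (Fin n ⊕ Fin n) ℝ) i j =
      ∑ a, ∑ b, ((1 / 2 : ℝ) * (x.1 a b.swap * sympSign b)) * spGenMatrix a b i j := by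
    simp only [AddSubmonoidClass.coe_finsetSum, Matrix.sum_apply]
    rfl
  rw [h1]
  have hF : ∀ c : Fin n ⊕ Fin n, sympForm c j = if c = j.swap then sympSign c else 0 := by
    intro c
    unfold sympForm
    by_cases h : c = j.swap
    · subst h; simp
    · have : j ≠ c.swap := fun h' => h (by simp [h'])
      simp [h, this]
  simp only [spGenMatrix_apply, hF, mul_add, Finset.sum_add_distrib, mul_ite, mul_zero]
  have e1 : ∑ a, ∑ b, (if i = a then if b = j.swap then
      (1 / 2 : ℝ) * (x.1 a b.swap * sympSign b) * sympSign b else 0 else 0) = 1 / 2 * x.1 i j := by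
    rw [Finset.sum_eq_single i (by intro b _ hb; simp [hb.symm]) (by simp)]
    simp [mul_assoc, sympSign_mul_self]
  have e2 : ∑ a, ∑ b, (if i = b then if a = j.swap then
      (1 / 2 : ℝ) * (x.1 a b.swap * sympSign b) * sympSign a else 0 else 0) = 1 / 2 * x.1 i j := by
    rw [Finset.sum_comm, Finset.sum_eq_single i (by intro b _ hb; simp [hb.symm]) (by simp)]
    simp only [if_true, Finset.sum_ite_eq', Finset.mem_univ]
    rw [← hx i j.swap]
    simp [mul_assoc, sympSign_mul_self]
  rw [e1, e2]; ring

theorem spGen_lie_single (a b c : Fin n ⊕ Fin n) :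
    ⁅spGen a b, (Pi.single c 1 : StdRep n)⁆ =
      sympForm b c • (Pi.single a 1 : StdRep n) + sympForm a c • (Pi.single b 1 : StdRep n) := by
  change Matrix.mulVec (spGenMatrix a b) (Pi.single c 1) = _
  simp only [spGenMatrix, Matrix.add_mulVec, Matrix.vecMulVec_mulVec, sympRow_dotProduct]
  simp

end Generators

/-! ### Identities and finite-dimensional facts for `𝔰𝔩₂`-triples. -/

section Sl2

variable {A : Type*} [Ring A] [Algebra ℝ A]

theorem sl2_h_mul_pow {e h : A} (he : h * e - e * h = (2 : ℝ) • e) (k : ℕ) :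
    h * e ^ k = e ^ k * h + (2 * k : ℝ) • e ^ k := by
  induction k with
  | zero => simp
  | succ k ih =>
    have he' : h * e = e * h + (2 : ℝ) • e := by rw [← he]; abel
    rw [pow_succ, ← mul_assoc, ih, add_mul, mul_assoc, he', mul_add, smul_mul_assoc,
      mul_smul_comm, mul_assoc]
    push_cast
    module

theorem sl2_pow_succ_mul_f {e f h : A} (hef : e * f - f * e = h)
    (he : h * e - e * h = (2 : ℝ) • e) (k : ℕ) :
    e ^ (k + 1) * f = f * e ^ (k + 1) + (k + 1 : ℝ) • (e ^ k * h + (k : ℝ) • e ^ k) := by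
  have hef' : e * f = f * e + h := by rw [← hef]; abel
  induction k with
  | zero => simp [hef']
  | succ k ih =>
    have h1 : e * (f * e ^ (k + 1)) = f * e ^ (k + 2) + h * e ^ (k + 1) := by
      rw [← mul_assoc, hef', add_mul, mul_assoc, ← pow_succ']
    have h2 : e * (e ^ k * h) = e ^ (k + 1) * h := by rw [← mul_assoc, ← pow_succ']
    rw [pow_succ' e (k + 1), mul_assoc, ih, mul_add, h1, sl2_h_mul_pow he (k + 1)]
    simp only [mul_smul_comm, mul_add, h2, ← pow_succ']
    push_cast
    module

/-- Commuting `e² = 0` past `f` gives `e h = -e`. Then `e f h = e f` and `f e h = -f e`, so `h² = e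
f + f e` and `h³ = e f - f e = h`. -/
theorem sl2_h_cube_of_sq_eq_zero {e f h : A} (hef : e * f - f * e = h)
    (he : h * e - e * h = (2 : ℝ) • e) (hf : h * f - f * h = (-2 : ℝ) • f) (h0 : e * e = 0) :
    h * h * h = h := by
  have h1 := sl2_pow_succ_mul_f hef he 1
  have h2 : e * h = -e := by
    norm_num [pow_two, h0] at h1
    rw [← smul_add] at h1
    exact eq_neg_of_add_eq_zero_left ((smul_eq_zero.1 h1.symm).resolve_left (by norm_num))
  have h3 : e * f * h = e * h * f + (2 : ℝ) • (e * f) := by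
    have : f * h = h * f + (2 : ℝ) • f := by
      rw [show h * f = f * h + (-2 : ℝ) • f by rw [← hf]; abel]; module
    rw [mul_assoc, this, mul_add, mul_smul_comm, mul_assoc]
  have h4 : e * f * h = e * f := by rw [h3, h2, neg_mul]; module
  have h5 : f * e * h = -(f * e) := by rw [mul_assoc, h2, mul_neg]
  have h6 : h * h = e * f + f * e := by
    nth_rw 1 [← hef]
    rw [sub_mul, h4, h5]; abel
  rw [h6, add_mul, h4, h5, ← hef]; abel

variable {V : Type*} [AddCommGroup V] [Module ℝ V] [FiniteDimensional ℝ V]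

/-- The nonzero powers `e ^ k` are eigenvectors of `ad h` with distinct eigenvalues `2k`, so only
finitely many can occur. -/
theorem sl2_isNilpotent {e h : Module.End ℝ V} (he : h * e - e * h = (2 : ℝ) • e) :
    IsNilpotent e := by
  by_contra hnil
  have hne : ∀ k, e ^ k ≠ 0 := fun k hk => hnil ⟨k, hk⟩
  let T : Module.End ℝ (Module.End ℝ V) := LinearMap.mulLeft ℝ h - LinearMap.mulRight ℝ h
  have hT : ∀ k : ℕ, T.HasEigenvector (2 * k : ℝ) (e ^ k) := by
    intro k
    refine ⟨Module.End.mem_eigenspace_iff.2 ?_, hne k⟩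
    simp [T, sl2_h_mul_pow he k]
  have hli := Module.End.eigenvectors_linearIndependent' T (fun k : ℕ => (2 * k : ℝ))
    (fun a b hab => by simpa using hab) _ hT
  have := hli.finite
  exact not_finite ℕ

/-- Exchanging `e` and `f` makes `v` primitive of weight `-μ`, which is then a natural number. -/
theorem sl2_weight_nonpos {e f h : Module.End ℝ V} (hef : e * f - f * e = h)
    (he : h * e - e * h = (2 : ℝ) • e) (hf : h * f - f * h = (-2 : ℝ) • f) {v : V} {μ : ℝ}
    (hv : v ≠ 0) (hfv : f v = 0) (hhv : h v = μ • v) : μ ≤ 0 := by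
  by_cases h0 : h = 0
  · rw [h0, LinearMap.zero_apply, eq_comm, smul_eq_zero] at hhv
    exact (hhv.resolve_right hv).le
  have t : IsSl2Triple h e f := by
    refine ⟨h0, hef, ?_, ?_⟩
    · rw [LieRing.of_associative_ring_bracket, he]; module
    · rw [LieRing.of_associative_ring_bracket, hf]; module
  have P : t.symm.HasPrimitiveVectorWith v (-μ) := ⟨hv, by simp [hhv], hfv⟩
  obtain ⟨k, hk⟩ := P.exists_nat
  have : (0 : ℝ) ≤ k := k.cast_nonneg
  linarith

end Sl2

/-! ### Maximal monomials in commuting raising operators. -/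

section Monomials

variable {A : Type*} [Ring A] {ι : Type*}

/-- `x` behaves like the monomial `∏ E m ^ k m` in commuting raising operators of commuting
`𝔰𝔩₂`-triples `(E m, H m, F m)`. -/
def IsRaisingMonomial (E F H : ι → A) (x : A) (k : ι → ℕ) : Prop :=
  ∀ m, ∃ y, x = y * E m ^ k m ∧ Commute y (F m) ∧ Commute y (H m)

variable {E F H : ι → A}

theorem isRaisingMonomial_one : IsRaisingMonomial E F H 1 0 := fun _ =>
  ⟨1, by simp, Commute.one_left _, Commute.one_left _⟩

theorem IsRaisingMonomial.mul [DecidableEq ι] (hEE : ∀ i j, Commute (E i) (E j))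
    (hEF : ∀ i j, i ≠ j → Commute (E i) (F j)) (hEH : ∀ i j, i ≠ j → Commute (E i) (H j))
    {x : A} {k : ι → ℕ} (hx : IsRaisingMonomial E F H x k) (j : ι) :
    IsRaisingMonomial E F H (x * E j) (k + Pi.single j 1) := by
  intro m
  obtain ⟨y, rfl, h1, h2⟩ := hx m
  by_cases hm : j = m
  · subst hm
    exact ⟨y, by simp [pow_succ, mul_assoc], h1, h2⟩
  · refine ⟨y * E j, ?_, h1.mul_left (hEF j m hm), h2.mul_left (hEH j m hm)⟩
    have : (k + Pi.single j 1 : ι → ℕ) m = k m := by simp [Ne.symm hm]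
    rw [this, mul_assoc, mul_assoc, ((hEE m j).pow_left _).eq]

/-- Write `x = y e^k`. Since `y` commutes with `f`, moving `f` through `y e^(k+1) = 0` gives `x h =
-k x`; since `y` commutes with `h`, `h x = x h + 2k x = k x`. Thus the image of a maximal monomial
consists of weight vectors. -/
theorem IsRaisingMonomial.h_mul [Algebra ℝ A] (hef : ∀ m, E m * F m - F m * E m = H m)
    (he : ∀ m, H m * E m - E m * H m = (2 : ℝ) • E m)
    {x : A} {k : ι → ℕ} (hx : IsRaisingMonomial E F H x k) {m : ι} (h0 : x * E m = 0) :
    H m * x = (k m : ℝ) • x := by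
  obtain ⟨y, rfl, h1, h2⟩ := hx m
  have e1 := congrArg (y * ·) (sl2_pow_succ_mul_f (hef m) (he m) (k m))
  simp only [mul_add, mul_smul_comm] at e1
  rw [mul_assoc, ← pow_succ] at h0
  rw [← mul_assoc, h0, ← mul_assoc, h1.eq, mul_assoc, h0, mul_zero, zero_mul, zero_add,
    eq_comm, smul_eq_zero] at e1
  have e2 := e1.resolve_left (by positivity)
  rw [← mul_assoc, ← h2.eq, mul_assoc, sl2_h_mul_pow (he m), mul_add, eq_neg_of_add_eq_zero_left e2,
    mul_smul_comm]
  module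

theorem IsRaisingMonomial.exists_maximal [DecidableEq ι] [Fintype ι] (hEE : ∀ i j, Commute (E i) (E j))
    (hEF : ∀ i j, i ≠ j → Commute (E i) (F j)) (hEH : ∀ i j, i ≠ j → Commute (E i) (H j))
    {N : ℕ} (hN : ∀ m, E m ^ N = 0) {x : A} {k : ι → ℕ} (hx : IsRaisingMonomial E F H x k)
    (h0 : x ≠ 0) :
    ∃ x' k', IsRaisingMonomial E F H x' k' ∧ x' ≠ 0 ∧ k ≤ k' ∧ ∀ m, x' * E m = 0 := by
  induction hM : Fintype.card ι * N - ∑ m, k m using Nat.strong_induction_on generalizing x k with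
  | _ M ih =>
  by_cases hmax : ∀ m, x * E m = 0
  · exact ⟨x, k, hx, h0, le_rfl, hmax⟩
  push Not at hmax
  obtain ⟨j, hj⟩ := hmax
  have hx' := hx.mul hEE hEF hEH j
  have hlt : ∑ m, (k + Pi.single j 1 : ι → ℕ) m ≤ Fintype.card ι * N := by
    rw [← smul_eq_mul, ← Finset.card_univ]
    refine Finset.sum_le_card_nsmul _ _ _ fun m _ => ?_
    obtain ⟨y, hy, -, -⟩ := hx' m
    by_contra hc
    rw [hy, pow_eq_zero_of_le (not_le.1 hc).le (hN m), mul_zero] at hj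
    exact hj rfl
  have hsum : ∑ m, (k + Pi.single j 1 : ι → ℕ) m = ∑ m, k m + 1 := by
    simp [Finset.sum_add_distrib]
  obtain ⟨x', k', h1, h2, h3, h4⟩ := ih _ (by omega) hx' hj rfl
  exact ⟨x', k', h1, h2, le_trans (by intro m; simp) h3, h4⟩

end Monomials

/-! ### Weights of a representation and vanishing of products of long root operators. -/

section SpSystem

variable {n : ℕ} {V : Type*} [AddCommGroup V] [Module ℝ V]

/-- Operators satisfying the relations of the generators `spGen a b` of `𝔰𝔭(n, ℝ)`. -/
structure IsSpSystem (Q : Fin n ⊕ Fin n → Fin n ⊕ Fin n → Module.End ℝ V) : Prop where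
  comm : ∀ a b, Q a b = Q b a
  lie : ∀ a b c d, Q a b * Q c d - Q c d * Q a b = sympForm b c • Q a d + sympForm a c • Q b d +
    sympForm b d • Q a c + sympForm a d • Q b c

/-- The coroot of the long root `2 • stdWeight c`. -/
def cartan (Q : Fin n ⊕ Fin n → Fin n ⊕ Fin n → Module.End ℝ V) (c : Fin n ⊕ Fin n) :
    Module.End ℝ V := -(sympSign c • Q c c.swap)

/-- `v` is a (possibly zero) joint eigenvector of the Cartan subalgebra, of weight `l`. -/
def IsWeightVec (Q : Fin n ⊕ Fin n → Fin n ⊕ Fin n → Module.End ℝ V) (l : Fin n → ℤ) (v : V) :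
    Prop := ∀ c, cartan Q c v = (coordOf l c : ℝ) • v

/-- The set of weights of a system of operators. -/
def weightSet (Q : Fin n ⊕ Fin n → Fin n ⊕ Fin n → Module.End ℝ V) : Set (Fin n → ℤ) :=
  {l | ∃ v, v ≠ 0 ∧ IsWeightVec Q l v}

theorem ne_swap_comm {x y : Fin n ⊕ Fin n} (h : x ≠ y.swap) : y ≠ x.swap :=
  fun h' => h (by simp [h'])

theorem swap_ne_swap {x y : Fin n ⊕ Fin n} (h : x ≠ y) : x.swap ≠ y.swap :=
  fun h' => h (by simpa using congrArg Sum.swap h')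

theorem sympForm_eq_zero {a b : Fin n ⊕ Fin n} (h : a ≠ b.swap) : sympForm a b = 0 := by
  simp [sympForm, ne_swap_comm h]

@[simp] theorem sympForm_self_swap (a : Fin n ⊕ Fin n) : sympForm a a.swap = sympSign a := by
  simp [sympForm]

@[simp] theorem sympForm_swap_self (a : Fin n ⊕ Fin n) : sympForm a.swap a = -sympSign a := by
  simp [sympForm, sympSign_swap]

@[simp] theorem sympForm_self (a : Fin n ⊕ Fin n) : sympForm a a = 0 :=
  sympForm_eq_zero (sum_swap_ne a).symm

namespace IsSpSystem

variable {Q : Fin n ⊕ Fin n → Fin n ⊕ Fin n → Module.End ℝ V} (hQ : IsSpSystem Q)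
include hQ

theorem cartan_swap (c : Fin n ⊕ Fin n) : cartan Q c.swap = -cartan Q c := by
  simp [cartan, sympSign_swap, hQ.comm c.swap c]

theorem cartan_lie (c a b : Fin n ⊕ Fin n) :
    cartan Q c * Q a b - Q a b * cartan Q c =
      ((coordOf (stdWeight a + stdWeight b) c : ℤ) : ℝ) • Q a b := by
  have key : ∀ a b, -(sympSign c • (sympForm c.swap a • Q c b + sympForm c a • Q c.swap b)) =
      ((coordOf (stdWeight a) c : ℤ) : ℝ) • Q a b := by
    intro a b
    rw [coordOf_stdWeight]
    by_cases h1 : a = c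
    · subst h1
      simp [smul_smul, sympSign_mul_self]
    · by_cases h2 : a = c.swap
      · subst h2
        simp [smul_smul, sympSign_mul_self, sum_swap_ne]
      · rw [sympForm_eq_zero (swap_ne_swap (Ne.symm h1)), sympForm_eq_zero (ne_swap_comm h2)]
        simp [h1, h2]
  have h := hQ.lie c c.swap a b
  have e : cartan Q c * Q a b - Q a b * cartan Q c =
      -(sympSign c • (Q c c.swap * Q a b - Q a b * Q c c.swap)) := by
    simp only [cartan, neg_mul, mul_neg, smul_mul_assoc, mul_smul_comm, smul_sub]
    abel
  rw [e, h, coordOf_add, Int.cast_add, add_smul, ← key a b, hQ.comm a b, ← key b a,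
    hQ.comm c a, hQ.comm c.swap a, hQ.comm a c, hQ.comm a c.swap]
  module

theorem isWeightVec_apply {l : Fin n → ℤ} {v : V} (hv : IsWeightVec Q l v)
    (a b : Fin n ⊕ Fin n) : IsWeightVec Q (l + stdWeight a + stdWeight b) (Q a b v) := by
  intro c
  have h := LinearMap.congr_fun (hQ.cartan_lie c a b) v
  simp only [LinearMap.sub_apply, Module.End.mul_apply, LinearMap.smul_apply, hv c,
    map_smul] at h
  rw [sub_eq_iff_eq_add] at h
  rw [h]
  simp only [coordOf_add]
  push_cast
  module

theorem cartan_commute (c d : Fin n ⊕ Fin n) : cartan Q c * cartan Q d = cartan Q d * cartan Q c := by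
  have h := hQ.cartan_lie c d d.swap
  rw [stdWeight_swap, add_neg_cancel, coordOf_zero, Int.cast_zero, zero_smul, sub_eq_zero] at h
  simp only [cartan, neg_mul, mul_neg, smul_mul_assoc, mul_smul_comm] at h ⊢
  rw [neg_inj] at h
  rw [h]
  module

theorem lie_opposite_self (c : Fin n ⊕ Fin n) :
    Q c c * Q c.swap c.swap - Q c.swap c.swap * Q c c = (-4 : ℝ) • cartan Q c := by
  rw [hQ.lie]
  simp only [sympForm_self_swap, cartan]
  module

theorem lie_opposite {c d : Fin n ⊕ Fin n} (h1 : c ≠ d) :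
    Q c d * Q c.swap d.swap - Q c.swap d.swap * Q c d =
      -(sympSign c * sympSign d) • (cartan Q c + cartan Q d) := by
  rw [hQ.lie, sympForm_eq_zero (a := d) (b := c.swap) (by simpa using h1.symm),
    sympForm_eq_zero (a := c) (b := d.swap) (by simpa using h1)]
  simp only [sympForm_self_swap, cartan]
  rcases sympSign_eq c with hc | hc <;> rcases sympSign_eq d with hd | hd <;> rw [hc, hd] <;>
    module

section Finite

variable [FiniteDimensional ℝ V]

/-- In the `𝔰𝔩₂` of the root a vector killed by the lowering operator has nonpositive weight. The
scalars below normalise the triple, separately for long and short roots. -/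
theorem apply_ne_zero_of_pos {l : Fin n → ℤ} {v : V} (hv : IsWeightVec Q l v) (h0 : v ≠ 0)
    {c d : Fin n ⊕ Fin n} (hcd : c ≠ d.swap) (hpos : 0 < coordOf l c + coordOf l d) :
    Q c.swap d.swap v ≠ 0 := by
  intro hzero
  have hdc := ne_swap_comm hcd
  by_cases h : c = d
  · subst h
    have hpos' : (0 : ℝ) < coordOf l c := by exact_mod_cast (by omega : 0 < coordOf l c)
    refine absurd (sl2_weight_nonpos (e := -(1 / 4 : ℝ) • Q c c) (f := Q c.swap c.swap)
      (h := cartan Q c) ?_ ?_ ?_ h0 hzero (hv c)) (not_le.2 hpos')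
    · rw [smul_mul_assoc, mul_smul_comm, ← smul_sub, hQ.lie_opposite_self]
      module
    · rw [smul_mul_assoc, mul_smul_comm, ← smul_sub, hQ.cartan_lie]
      simp [coordOf_stdWeight]
      module
    · rw [hQ.cartan_lie]
      simp [coordOf_stdWeight, stdWeight_swap]
  · have hpos' : (0 : ℝ) < (coordOf l c : ℝ) + coordOf l d := by exact_mod_cast hpos
    have hs : sympSign c * sympSign d * (sympSign c * sympSign d) = 1 := by
      rw [mul_mul_mul_comm, sympSign_mul_self, sympSign_mul_self, one_mul]
    refine absurd (sl2_weight_nonpos (e := -(sympSign c * sympSign d) • Q c d)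
      (f := Q c.swap d.swap) (h := cartan Q c + cartan Q d) (μ := coordOf l c + coordOf l d)
      ?_ ?_ ?_ h0 hzero (by rw [LinearMap.add_apply, hv c, hv d, add_smul])) (not_le.2 hpos')
    · rw [smul_mul_assoc, mul_smul_comm, ← smul_sub, hQ.lie_opposite h, smul_smul,
        neg_mul_neg, hs, one_smul]
    · rw [smul_mul_assoc, mul_smul_comm, ← smul_sub, add_mul, mul_add, add_sub_add_comm,
        hQ.cartan_lie, hQ.cartan_lie]
      simp [coordOf_stdWeight, h, hcd, Ne.symm h, hdc]
      module
    · rw [add_mul, mul_add, add_sub_add_comm, hQ.cartan_lie, hQ.cartan_lie]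
      simp [coordOf_stdWeight, h, hcd, Ne.symm h, hdc, stdWeight_swap]
      module

theorem stepClosed_weightSet : StepClosed (weightSet Q) := by
  rintro l ⟨v, h0, hv⟩ c d hcd hpos
  refine ⟨_, hQ.apply_ne_zero_of_pos hv h0 hcd hpos, ?_⟩
  have := hQ.isWeightVec_apply hv c.swap d.swap
  rwa [stdWeight_swap, stdWeight_swap, ← sub_eq_add_neg, ← sub_eq_add_neg] at this

theorem card_le_finrank_of_subset_weightSet (F : Finset (Fin n → ℤ)) (hF : ↑F ⊆ weightSet Q) :
    F.card ≤ Module.finrank ℝ V := by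
  have hF' : ∀ l ∈ F, ∃ v, v ≠ 0 ∧ IsWeightVec Q l v := fun l hl => hF hl
  choose! v hv0 hv using hF'
  have hind := Module.End.independent_iInf_maxGenEigenspace_of_forall_mapsTo
    (fun i : Fin n => cartan Q (Sum.inl i)) (fun i j φ =>
      Module.End.mapsTo_maxGenEigenspace_of_comm (hQ.cartan_commute _ _) φ)
  have hind' : iSupIndep fun l : F => ⨅ i, (cartan Q (Sum.inl i)).maxGenEigenspace (l.1 i : ℝ) :=
    hind.comp (f := fun l : F => fun i => (l.1 i : ℝ)) (fun a b h => Subtype.ext (by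
      funext i; simpa using congrFun h i))
  have hli : LinearIndependent ℝ fun l : F => v l.1 := by
    refine hind'.linearIndependent _ (fun l => ?_) (fun l => hv0 l.1 l.2)
    rw [Submodule.mem_iInf]
    intro i
    refine Module.End.mem_maxGenEigenspace _ _ _ |>.2 ⟨1, ?_⟩
    have := hv l.1 l.2 (Sum.inl i)
    simp [this, coordOf]
  simpa using hli.fintype_card_le_finrank

theorem eq_zero_or_stdWeight (hn : 3 ≤ n) (hdim : Module.finrank ℝ V ≤ 4 * n) {l : Fin n → ℤ}
    (hl : l ∈ weightSet Q) : l = 0 ∨ ∃ c, l = stdWeight c :=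
  eq_zero_or_stdWeight_of_stepClosed hn hQ.stepClosed_weightSet
    (fun F hF => (hQ.card_le_finrank_of_subset_weightSet F hF).trans hdim) hl

theorem long_mul_long (hn : 3 ≤ n) (hdim : Module.finrank ℝ V ≤ 4 * n) (i j : Fin n) :
    Q (Sum.inl i) (Sum.inl i) * Q (Sum.inl j) (Sum.inl j) = 0 := by
  let E : Fin n → Module.End ℝ V := fun m => (1 / 2 : ℝ) • Q (Sum.inl m) (Sum.inl m)
  let F : Fin n → Module.End ℝ V := fun m => -(1 / 2 : ℝ) • Q (Sum.inr m) (Sum.inr m)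
  let H : Fin n → Module.End ℝ V := fun m => cartan Q (Sum.inl m)
  have hef : ∀ m, E m * F m - F m * E m = H m := by
    intro m
    have := hQ.lie_opposite_self (Sum.inl m)
    simp only [Sum.swap_inl] at this
    simp only [E, F, H, smul_mul_assoc, mul_smul_comm]
    rw [show cartan Q (Sum.inl m) = (-(1 / 4) : ℝ) • (-4 : ℝ) • cartan Q (Sum.inl m) by module,
      ← this]
    module
  have he : ∀ m, H m * E m - E m * H m = (2 : ℝ) • E m := by
    intro m
    simp only [E, H, smul_mul_assoc, mul_smul_comm]
    rw [← smul_sub, hQ.cartan_lie]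
    simp [coordOf_stdWeight]
  have hEE : ∀ i j, Commute (E i) (E j) := by
    intro i j
    refine Commute.smul_left (Commute.smul_right (sub_eq_zero.1 ?_) _) _
    rw [hQ.lie, sympForm_eq_zero (by simp)]
    simp
  have hEF : ∀ i j, i ≠ j → Commute (E i) (F j) := by
    intro i j hij
    refine Commute.smul_left (Commute.smul_right (sub_eq_zero.1 ?_) _) _
    rw [hQ.lie, sympForm_eq_zero (by simpa using hij)]
    simp
  have hEH : ∀ i j, i ≠ j → Commute (E i) (H j) := by
    intro i j hij
    refine Commute.smul_left (sub_eq_zero.1 ?_).symm _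
    rw [hQ.cartan_lie]
    simp [coordOf_stdWeight, hij]
  by_contra hne
  have hmon := (isRaisingMonomial_one (E := E) (F := F) (H := H)).mul hEE hEF hEH i
    |>.mul hEE hEF hEH j
  choose N hN using fun m => sl2_isNilpotent (he m)
  obtain ⟨x, k, hx, hx0, hk, hmax⟩ := hmon.exists_maximal hEE hEF hEH
    (N := ∑ m, N m) (fun m => pow_eq_zero_of_le (Finset.single_le_sum (fun _ _ => Nat.zero_le _)
      (Finset.mem_univ m)) (hN m)) (by
        simp only [one_mul, E, smul_mul_assoc, mul_smul_comm, smul_smul]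
        exact smul_ne_zero (by norm_num) hne)
  obtain ⟨u, hu⟩ : ∃ u, x u ≠ 0 := by
    by_contra hc
    push Not at hc
    exact hx0 (LinearMap.ext hc)
  -- The exponents of the maximal monomial form a weight; as `E i * E j` divides it, their sum is at
  -- least `2`.
  have hmem : (fun m => (k m : ℤ)) ∈ weightSet Q := by
    refine ⟨x u, hu, ?_⟩
    have h1 : ∀ m, cartan Q (Sum.inl m) (x u) = (k m : ℝ) • x u := fun m =>
      LinearMap.congr_fun (hx.h_mul hef he (hmax m)) u
    rintro (m | m)
    · simpa [coordOf] using h1 m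
    · have := hQ.cartan_swap (Sum.inl m)
      rw [Sum.swap_inl] at this
      rw [this, LinearMap.neg_apply, h1]
      simp [coordOf]
  have hi := hk i
  have hj := hk j
  simp only [Pi.add_apply, zero_add, Pi.single_apply, if_true] at hi hj
  rcases hQ.eq_zero_or_stdWeight hn hdim hmem with h | ⟨c | c, h⟩
  · have := congrFun h i
    simp at this; omega
  · have h1 := congrFun h i
    have h2 := congrFun h j
    simp only [stdWeight, Sum.elim_inl, Pi.single_apply] at h1 h2
    split_ifs at * <;> omega
  · have h1 := congrFun h i
    simp only [stdWeight, Sum.elim_inr, Pi.single_apply] at h1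
    split_ifs at * <;> omega

end Finite

end IsSpSystem

end SpSystem

/-! ### Diagonal action of the Cartan subalgebra and transport between weight spaces. -/

section Transfer

variable {n : ℕ} {V : Type*} [AddCommGroup V] [Module ℝ V]

/-- The normalised isomorphism from the weight space of `stdWeight a` to that of `stdWeight c`. -/
noncomputable def transfer (Q : Fin n ⊕ Fin n → Fin n ⊕ Fin n → Module.End ℝ V)
    (c a : Fin n ⊕ Fin n) : Module.End ℝ V :=
  if c = a then 1 else if c = a.swap then (-(sympSign a) / 2) • Q c a.swap
    else (-(sympSign a)) • Q c a.swap

namespace IsSpSystem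

variable [FiniteDimensional ℝ V]
variable {Q : Fin n ⊕ Fin n → Fin n ⊕ Fin n → Module.End ℝ V} (hQ : IsSpSystem Q)
  (hn : 3 ≤ n) (hdim : Module.finrank ℝ V ≤ 4 * n)
include hQ hn hdim

theorem cartan_inl_cube (i : Fin n) :
    cartan Q (Sum.inl i) * cartan Q (Sum.inl i) * cartan Q (Sum.inl i) = cartan Q (Sum.inl i) := by
  refine sl2_h_cube_of_sq_eq_zero (e := -(1 / 4 : ℝ) • Q (Sum.inl i) (Sum.inl i))
    (f := Q (Sum.inr i) (Sum.inr i)) ?_ ?_ ?_ ?_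
  · have := hQ.lie_opposite_self (Sum.inl i)
    rw [Sum.swap_inl] at this
    rw [smul_mul_assoc, mul_smul_comm, ← smul_sub, this]
    module
  · rw [smul_mul_assoc, mul_smul_comm, ← smul_sub, hQ.cartan_lie]
    simp [coordOf_stdWeight]
    module
  · rw [hQ.cartan_lie]
    simp [coordOf_stdWeight]
  · rw [smul_mul_assoc, mul_smul_comm, hQ.long_mul_long hn hdim]
    simp

theorem cartan_cube (c : Fin n ⊕ Fin n) :
    cartan Q c * cartan Q c * cartan Q c = cartan Q c := by
  rcases c with c | c
  · exact hQ.cartan_inl_cube hn hdim c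
  · have := hQ.cartan_swap (Sum.inl c)
    rw [Sum.swap_inl] at this
    rw [this, neg_mul_neg, mul_neg, hQ.cartan_inl_cube hn hdim c]

/-- Expanding `H_i` as a multiple of `[E_i, F_i]` and using `E_i E_j = 0` gives `H_i E_j = 0`. As
`H_i` commutes with `F_j`, expanding `H_j` in the same way gives `H_i H_j = 0`. -/
theorem cartan_inl_mul_cartan_inl {i j : Fin n} (hij : i ≠ j) :
    cartan Q (Sum.inl i) * cartan Q (Sum.inl j) = 0 := by
  have h0 := hQ.long_mul_long hn hdim i j
  have hc : ∀ i j : Fin n, i ≠ j → Q (Sum.inr i) (Sum.inr i) * Q (Sum.inl j) (Sum.inl j) =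
      Q (Sum.inl j) (Sum.inl j) * Q (Sum.inr i) (Sum.inr i) := by
    intro i j hij
    rw [← sub_eq_zero, hQ.lie, sympForm_eq_zero (by simpa using hij)]
    simp
  have hl : ∀ i : Fin n, cartan Q (Sum.inl i) = (-(1 / 4 : ℝ)) •
      (Q (Sum.inl i) (Sum.inl i) * Q (Sum.inr i) (Sum.inr i) -
        Q (Sum.inr i) (Sum.inr i) * Q (Sum.inl i) (Sum.inl i)) := by
    intro i
    have := hQ.lie_opposite_self (Sum.inl i)
    rw [Sum.swap_inl] at this
    rw [this]; module
  have h1 : cartan Q (Sum.inl i) * Q (Sum.inl j) (Sum.inl j) = 0 := by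
    rw [hl, smul_mul_assoc, sub_mul, mul_assoc, hc i j hij, ← mul_assoc, h0, zero_mul, mul_assoc,
      h0, mul_zero, sub_zero, smul_zero]
  have h2 : cartan Q (Sum.inl i) * Q (Sum.inr j) (Sum.inr j) =
      Q (Sum.inr j) (Sum.inr j) * cartan Q (Sum.inl i) := by
    rw [← sub_eq_zero, hQ.cartan_lie]
    simp [coordOf_stdWeight, hij.symm]
  rw [hl j, mul_smul_comm, mul_sub, ← mul_assoc, h1, zero_mul, ← mul_assoc, h2, mul_assoc, h1,
    mul_zero, sub_zero, smul_zero]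

theorem cartan_mul_cartan {c d : Fin n ⊕ Fin n} (h1 : c ≠ d) (h2 : c ≠ d.swap) :
    cartan Q c * cartan Q d = 0 := by
  have hs : ∀ i : Fin n, cartan Q (Sum.inr i) = -cartan Q (Sum.inl i) := fun i =>
    hQ.cartan_swap (Sum.inl i)
  rcases c with c | c <;> rcases d with d | d <;>
    (try simp only [hs, neg_mul, mul_neg, neg_eq_zero]) <;>
    exact hQ.cartan_inl_mul_cartan_inl hn hdim (by rintro rfl; simp at h1 h2)

theorem isWeightVec_stdWeight {a : Fin n ⊕ Fin n} {v : V} (hv : cartan Q a v = v) :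
    IsWeightVec Q (stdWeight a) v := by
  intro c
  rw [coordOf_stdWeight]
  by_cases h1 : a = c
  · subst h1; simp [hv]
  by_cases h2 : a = c.swap
  · rw [show c = a.swap by simp [h2], hQ.cartan_swap]
    simp [hv, (sum_swap_ne a).symm]
  · rw [← hv, ← Module.End.mul_apply, hQ.cartan_mul_cartan hn hdim (Ne.symm h1) (ne_swap_comm h2)]
    simp [h1, h2]

/-- With no two of `a, b, d` opposite nothing cancels, so the sum is neither `0` nor a single
`±e_i`. -/
theorem eq_zero_of_isWeightVec {l : Fin n → ℤ} {v : V} (hv : IsWeightVec Q l v)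
    {a b d : Fin n ⊕ Fin n} (hl : l = stdWeight a + stdWeight b + stdWeight d) (hab : a ≠ b.swap) (had : a ≠ d.swap)
    (hbd : b ≠ d.swap) : v = 0 := by
  by_contra hne
  have hnn : ∀ x y : Fin n ⊕ Fin n, x ≠ y.swap → 0 ≤ coordOf (stdWeight x) y := by
    intro x y h; rw [coordOf_stdWeight]; split_ifs <;> simp
  have ha : 1 ≤ coordOf l a := by
    rw [hl, coordOf_add, coordOf_add]
    have := hnn b a (ne_swap_comm hab)
    have := hnn d a (ne_swap_comm had)
    simp only [coordOf_stdWeight a a, if_true]; omega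
  have hb : 1 ≤ coordOf l b := by
    rw [hl, coordOf_add, coordOf_add]
    have := hnn a b hab
    have := hnn d b (ne_swap_comm hbd)
    simp only [coordOf_stdWeight b b, if_true]; omega
  have hd : 1 ≤ coordOf l d := by
    rw [hl, coordOf_add, coordOf_add]
    have := hnn a d had
    have := hnn b d hbd
    simp only [coordOf_stdWeight d d, if_true]; omega
  rcases hQ.eq_zero_or_stdWeight hn hdim ⟨v, hne, hv⟩ with h | ⟨e, h⟩
  · rw [h] at ha; simp at ha
  · have key : ∀ x, 1 ≤ coordOf l x → e = x := by
      intro x hx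
      rw [h, coordOf_stdWeight] at hx
      by_contra hex
      rw [if_neg hex] at hx
      split_ifs at hx <;> omega
    obtain rfl := key a ha
    obtain rfl := key b hb
    obtain rfl := key d hd
    have := congrArg (coordOf · e) (h.symm.trans hl)
    simp [coordOf_stdWeight] at this

/-- A vector of weight `stdWeight a` is acted on as the basis vector `a` is, with `transfer Q c a v`
in place of `c`. The scalars in `transfer` are chosen for this; the half accounts for `Q c c`
doubling. -/
theorem apply_eq_transfer {a : Fin n ⊕ Fin n} {v : V} (hv : cartan Q a v = v)
    (c d : Fin n ⊕ Fin n) :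
    Q c d v = sympForm d a • transfer Q c a v + sympForm c a • transfer Q d a v := by
  have hw := hQ.isWeightVec_stdWeight hn hdim hv
  have key : ∀ c, c ≠ a.swap →
      Q c a.swap v = sympForm a.swap a • transfer Q c a v + sympForm c a • transfer Q a.swap a v := by
    intro c hc
    rw [sympForm_eq_zero hc, zero_smul, add_zero, sympForm_swap_self]
    by_cases h : c = a
    · subst h
      have : Q c c.swap = -(sympSign c) • cartan Q c := by
        rw [cartan, smul_neg, neg_smul, neg_neg, smul_smul, sympSign_mul_self, one_smul]
      rw [this]
      simp [transfer, hv]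
    · simp only [transfer, h, hc, if_false, LinearMap.smul_apply]
      rw [smul_smul, neg_mul_neg, sympSign_mul_self, one_smul]
  by_cases hd : d = a.swap
  · subst hd
    by_cases hc : c = a.swap
    · subst hc
      simp only [transfer, sum_swap_ne, if_false, if_true, LinearMap.smul_apply,
        sympForm_swap_self]
      rcases sympSign_eq a with h | h <;> rw [h] <;> module
    · exact key c hc
  by_cases hc : c = a.swap
  · subst hc
    rw [hQ.comm, key d hd, add_comm]
  rw [sympForm_eq_zero hd, sympForm_eq_zero hc, zero_smul, zero_smul, add_zero]
  by_cases hcd : c = d.swap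
  · subst hcd
    have h1 : a ≠ d := by rintro rfl; exact hc rfl
    have h2 : a ≠ d.swap := ne_swap_comm hd
    have := hw d
    rw [coordOf_stdWeight, if_neg h1, if_neg h2, Int.cast_zero, zero_smul, cartan,
      LinearMap.neg_apply, neg_eq_zero, LinearMap.smul_apply, smul_eq_zero] at this
    rw [hQ.comm]
    refine this.resolve_left ?_
    rcases sympSign_eq d with h | h <;> simp [h]
  · exact hQ.eq_zero_of_isWeightVec hn hdim (hQ.isWeightVec_apply hw c d) rfl (ne_swap_comm hc)
      (ne_swap_comm hd) hcd

theorem cartan_transfer {a : Fin n ⊕ Fin n} {v : V} (hv : cartan Q a v = v)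
    (c : Fin n ⊕ Fin n) : cartan Q c (transfer Q c a v) = transfer Q c a v := by
  have hw := hQ.isWeightVec_stdWeight hn hdim hv
  have h : cartan Q c (Q c a.swap v) = ((coordOf (stdWeight c) c : ℤ) : ℝ) • Q c a.swap v := by
    have := hQ.isWeightVec_apply hw c a.swap c
    rwa [stdWeight_swap, add_neg_cancel_comm] at this
  simp only [coordOf_stdWeight, if_true, Int.cast_one, one_smul] at h
  by_cases hca : c = a
  · subst hca; simp [transfer, hv]
  · simp only [transfer, hca, if_false]
    split_ifs <;> simp [h]

/-- Let `X = Q a.swap b.swap` and `Y = Q a b.swap`. The commutator `[X, Y]` is a multiple of `Q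
b.swap b.swap`, but here `Y X v` does not vanish. Applying `Q a.swap a.swap` to `Y² v = 0` shows `X
Y v + Y X v = 0`, so `X Y v` is half the commutator. -/
theorem transfer_transfer_swap {a b : Fin n ⊕ Fin n} {v : V} (hv : cartan Q b v = v)
    (h1 : a ≠ b) (h2 : a ≠ b.swap) :
    transfer Q b.swap a (transfer Q a b v) = transfer Q b.swap b v := by
  have hw := hQ.isWeightVec_stdWeight hn hdim hv
  have h3 : b ≠ a.swap := ne_swap_comm h2
  have hsq : Q a b.swap (Q a b.swap v) = 0 := by
    refine hQ.eq_zero_of_isWeightVec hn hdim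
      (hQ.isWeightVec_apply (hQ.isWeightVec_apply hw a b.swap) a b.swap)
      (a := a) (b := a) (d := b.swap) ?_ (sum_swap_ne a).symm (by simpa using h1)
      (by simpa using h1)
    rw [stdWeight_swap]; abel
  have haa : Q a.swap a.swap v = 0 := by
    rw [hQ.apply_eq_transfer hn hdim hv, sympForm_eq_zero (swap_ne_swap h1)]
    simp
  have hcomm : ∀ u, Q a.swap a.swap (Q a b.swap u) = Q a b.swap (Q a.swap a.swap u) +
      (2 * -(sympSign a)) • Q a.swap b.swap u := by
    intro u
    have h := LinearMap.congr_fun (hQ.lie a.swap a.swap a b.swap) u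
    rw [sympForm_eq_zero (a := a.swap) (b := b.swap) (by simpa using h3.symm)] at h
    simp only [LinearMap.sub_apply, Module.End.mul_apply, sympForm_swap_self, zero_smul, add_zero,
      LinearMap.add_apply, LinearMap.smul_apply] at h
    rw [sub_eq_iff_eq_add] at h
    rw [h]; module
  have hanti : Q a.swap b.swap (Q a b.swap v) + Q a b.swap (Q a.swap b.swap v) = 0 := by
    have e := hcomm (Q a b.swap v)
    rw [hsq, map_zero, hcomm v, haa, map_zero, zero_add, map_smul, ← smul_add, eq_comm,
      smul_eq_zero] at e
    rw [add_comm]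
    refine e.resolve_left ?_
    rcases sympSign_eq a with h | h <;> simp [h]
  have hlie := LinearMap.congr_fun (hQ.lie a.swap b.swap a b.swap) v
  rw [sympForm_eq_zero (a := b.swap) (b := a) (swap_ne_swap h1.symm), 
    sympForm_eq_zero (a := a.swap) (b := b.swap) (by simpa using h3.symm)] at hlie
  simp only [LinearMap.sub_apply, Module.End.mul_apply, sympForm_swap_self, sympForm_self,
    zero_smul, add_zero, zero_add, LinearMap.smul_apply] at hlie
  rw [eq_neg_of_add_eq_zero_right hanti, sub_neg_eq_add] at hlie
  simp only [transfer, h1, h2, swap_ne_swap h1.symm, h2.symm, sum_swap_ne, if_true, if_false,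
    LinearMap.smul_apply, map_smul, hQ.comm b.swap a.swap]
  have h5 : Q a.swap b.swap (Q a b.swap v) = (-(sympSign a) / 2) • Q b.swap b.swap v := by
    rw [← two_smul ℝ] at hlie
    rw [show Q a.swap b.swap (Q a b.swap v) =
      (1 / 2 : ℝ) • (2 : ℝ) • Q a.swap b.swap (Q a b.swap v) by module, hlie]
    module
  rw [h5]
  rcases sympSign_eq a with h | h <;> rw [h] <;> module

theorem transfer_transfer {b : Fin n ⊕ Fin n} {v : V} (hv : cartan Q b v = v)
    (c a : Fin n ⊕ Fin n) : transfer Q c a (transfer Q a b v) = transfer Q c b v := by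
  by_cases hab : a = b
  · subst hab; simp [transfer]
  by_cases hca : c = a
  · subst hca; simp [transfer]
  by_cases hcb : c = b.swap
  · subst hcb
    exact hQ.transfer_transfer_swap hn hdim hv hab (Ne.symm hca)
  -- For `c ≠ b.swap` and `a ≠ b` the operator `Q c a.swap` kills `v`, so the commutator is already
  -- the composite `Q c a.swap (Q a b.swap v)`.
  have hlie := LinearMap.congr_fun (hQ.lie c a.swap a b.swap) v
  simp only [LinearMap.sub_apply, Module.End.mul_apply, LinearMap.add_apply,
    LinearMap.smul_apply, hQ.apply_eq_transfer hn hdim hv c a.swap,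
    hQ.apply_eq_transfer hn hdim hv c b.swap,
    hQ.apply_eq_transfer hn hdim hv a.swap b.swap, hQ.apply_eq_transfer hn hdim hv c a,
    hQ.apply_eq_transfer hn hdim hv a.swap a] at hlie
  rw [sympForm_eq_zero hcb, sympForm_eq_zero (swap_ne_swap hab)] at hlie
  simp only [zero_smul, add_zero, map_zero, sub_zero, sympForm_swap_self] at hlie
  have hca' : transfer Q c a = (if c = a.swap then -(sympSign a) / 2 else -(sympSign a)) •
      Q c a.swap := by
    simp only [transfer, hca, if_false]; split_ifs <;> rfl
  have hab' : transfer Q a b = (if a = b.swap then -(sympSign b) / 2 else -(sympSign b)) •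
      Q a b.swap := by
    simp only [transfer, hab, if_false]; split_ifs <;> rfl
  rw [hca', hab', LinearMap.smul_apply, LinearMap.smul_apply, map_smul, hlie]
  by_cases h1 : c = a.swap
  · subst h1
    by_cases h2 : a = b.swap
    · subst h2
      simp only [Sum.swap_swap, sympSign_swap, sympForm_self_swap, sympForm_swap_self, if_true]
      rcases sympSign_eq b with h | h <;> rw [h] <;> module
    · have h3 : b ≠ a.swap := ne_swap_comm h2
      simp only [h2, sympForm_swap_self, if_true, if_false,
        sympForm_eq_zero h2, sympForm_eq_zero (a := a.swap) (b := b.swap) (by simpa using h3.symm)]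
      rcases sympSign_eq b with h | h <;> rcases sympSign_eq a with h' | h' <;> rw [h, h'] <;>
        module
  · by_cases h2 : a = b.swap
    · subst h2
      have h3 : c ≠ b := fun h => h1 (by simp [h])
      simp only [Sum.swap_swap, sympSign_swap, sympForm_self_swap, sympForm_swap_self, if_true, h3,
        sympForm_eq_zero h1]
      rcases sympSign_eq b with h | h <;> rw [h] <;> simp <;> module
    · have h3 : b ≠ a.swap := ne_swap_comm h2
      simp only [h1, h2, if_false, sympForm_eq_zero h1, sympForm_eq_zero h2,
        sympForm_eq_zero (a := a.swap) (b := b.swap) (by simpa using h3.symm)]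
      rcases sympSign_eq b with h | h <;> rcases sympSign_eq a with h' | h' <;> rw [h, h'] <;>
        module

end IsSpSystem

end Transfer

/-! ### Copies of the standard representation inside `V`. -/

section Embedding

variable {n : ℕ} {V : Type*} [AddCommGroup V] [Module ℝ V]

/-- The linear map from the standard representation sending the basis vector `c` to `w` and each
basis vector `a` to the transferred vector. -/
noncomputable def stdMap (Q : Fin n ⊕ Fin n → Fin n ⊕ Fin n → Module.End ℝ V)
    (c : Fin n ⊕ Fin n) (w : V) : StdRep n →ₗ[ℝ] V :=
  Fintype.linearCombination ℝ fun a => transfer Q a c w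

theorem stdMap_single (Q : Fin n ⊕ Fin n → Fin n ⊕ Fin n → Module.End ℝ V)
    (c a : Fin n ⊕ Fin n) (w : V) : stdMap Q c w (Pi.single a 1) = transfer Q a c w := by
  simp [stdMap, Fintype.linearCombination_apply_single]

namespace IsSpSystem

variable [FiniteDimensional ℝ V]
variable {Q : Fin n ⊕ Fin n → Fin n ⊕ Fin n → Module.End ℝ V} (hQ : IsSpSystem Q)
  (hn : 3 ≤ n) (hdim : Module.finrank ℝ V ≤ 4 * n)
include hQ hn hdim

/-- Without eigenvalue `1` at `c`, transport excludes it at every `d`, and `H³ = H` gives `H² + H =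
0`. The same for `-H`, the operator at `d.swap`, forces `H = 0`; then the commutators with the
Cartan operators kill all `Q a b`. -/
theorem exists_cartan_eq_self {a b : Fin n ⊕ Fin n} (hab : Q a b ≠ 0) (c : Fin n ⊕ Fin n) :
    ∃ w, w ≠ 0 ∧ cartan Q c w = w := by
  by_contra hno
  push Not at hno
  have h1 : ∀ d v, cartan Q d v = v → v = 0 := by
    intro d v hv
    have h2 : transfer Q c d v = 0 := by
      by_contra hne
      exact hno _ hne (hQ.cartan_transfer hn hdim hv c)
    have h3 := hQ.transfer_transfer hn hdim hv d c
    rw [h2, map_zero] at h3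
    simpa [transfer] using h3.symm
  have h2 : ∀ d, cartan Q d * cartan Q d + cartan Q d = 0 := by
    intro d
    ext v
    refine h1 d _ ?_
    have h3 := LinearMap.congr_fun (hQ.cartan_cube hn hdim d) v
    simp only [Module.End.mul_apply] at h3
    simp only [LinearMap.add_apply, Module.End.mul_apply, map_add, h3]
    abel
  have h3 : ∀ d, cartan Q d = 0 := by
    intro d
    have e1 := h2 d
    have e2 := h2 d.swap
    rw [hQ.cartan_swap, neg_mul_neg] at e2
    have e3 : (2 : ℝ) • cartan Q d = (cartan Q d * cartan Q d + cartan Q d) -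
      (cartan Q d * cartan Q d + -cartan Q d) := by module
    rw [e1, e2, sub_zero, smul_eq_zero] at e3
    exact e3.resolve_left (by norm_num)
  apply hab
  by_cases hb : b = a.swap
  · subst hb
    have := h3 a
    rw [cartan, neg_eq_zero, smul_eq_zero] at this
    refine this.resolve_left ?_
    rcases sympSign_eq a with h | h <;> simp [h]
  · have e := hQ.cartan_lie a a b
    rw [h3, zero_mul, mul_zero, sub_zero, eq_comm, smul_eq_zero] at e
    refine e.resolve_left ?_
    rw [coordOf_add, coordOf_stdWeight, coordOf_stdWeight]
    rw [if_pos rfl]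
    split_ifs <;> norm_num

/-- Choose `v` with `B w v ≠ 0`. Then `e v` has weight `e_i` and `B w (f (e v)) ≠ 0`, whereas `B w
(f w) = 0` because `f` is skew for a symmetric form. So `e v` is not a multiple of `w`. -/
theorem exists_linearIndependent_pair {a b : Fin n ⊕ Fin n} (hab : Q a b ≠ 0)
    (B : LinearMap.BilinForm ℝ V) (hsymm : B.IsSymm) (hnd : B.Nondegenerate)
    (hB : ∀ a b v w, B (Q a b v) w + B v (Q a b w) = 0) (i : Fin n) :
    ∃ w : Fin 2 → V, LinearIndependent ℝ w ∧ ∀ j, cartan Q (Sum.inl i) (w j) = w j := by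
  obtain ⟨w, hw0, hw⟩ := hQ.exists_cartan_eq_self hn hdim hab (Sum.inl i)
  obtain ⟨v, hv⟩ : ∃ v, B w v ≠ 0 := by
    by_contra hno
    push Not at hno
    exact hw0 (hnd.1 w hno)
  set e := Q (Sum.inl i) (Sum.inl i)
  set f := Q (Sum.inr i) (Sum.inr i)
  have hskew : ∀ u, B u (f u) = 0 := by
    intro u
    have h1 := hB (Sum.inr i) (Sum.inr i) u u
    have h2 := hsymm.eq (f u) u
    linarith
  have hef : e (f w) = (-4 : ℝ) • w := by
    have h1 := LinearMap.congr_fun (hQ.lie_opposite_self (Sum.inl i)) w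
    have h2 : e w = 0 := by
      have := hQ.apply_eq_transfer hn hdim hw (Sum.inl i) (Sum.inl i)
      simpa using this
    simp only [Sum.swap_inl, LinearMap.sub_apply, Module.End.mul_apply, LinearMap.smul_apply,
      hw] at h1
    change e (f w) - f (e w) = _ at h1
    rwa [h2, map_zero, sub_zero] at h1
  have hfe : B w (f (e v)) ≠ 0 := by
    have h1 := hB (Sum.inr i) (Sum.inr i) w (e v)
    have h2 := hB (Sum.inl i) (Sum.inl i) (f w) v
    change B (f w) (e v) + B w (f (e v)) = 0 at h1
    change B (e (f w)) v + B (f w) (e v) = 0 at h2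
    rw [hef, map_smul, LinearMap.smul_apply, smul_eq_mul] at h2
    intro h3
    apply hv
    linarith
  have hhe : cartan Q (Sum.inl i) (e v) = e v := by
    have h0 : e * e = 0 := hQ.long_mul_long hn hdim i i
    have he : cartan Q (Sum.inl i) * e - e * cartan Q (Sum.inl i) = (2 : ℝ) • e := by
      rw [hQ.cartan_lie]
      simp [coordOf_stdWeight]
      rfl
    have hf : e * (-(1 / 4 : ℝ) • f) - (-(1 / 4 : ℝ) • f) * e = cartan Q (Sum.inl i) := by
      have := hQ.lie_opposite_self (Sum.inl i)
      rw [Sum.swap_inl] at this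
      rw [smul_mul_assoc, mul_smul_comm, ← smul_sub, this]
      module
    have h1 := sl2_pow_succ_mul_f hf he 1
    norm_num [pow_two, h0] at h1
    rw [← smul_add] at h1
    have h2 : e * cartan Q (Sum.inl i) = -e :=
      eq_neg_of_add_eq_zero_left ((smul_eq_zero.1 h1.symm).resolve_left (by norm_num))
    rw [h2, sub_eq_iff_eq_add] at he
    have := LinearMap.congr_fun he v
    simp only [Module.End.mul_apply] at this
    rw [this]
    simp only [LinearMap.add_apply, LinearMap.smul_apply, LinearMap.neg_apply]
    module
  refine ⟨![w, e v], ?_, ?_⟩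
  · rw [LinearIndependent.pair_iff' hw0]
    rintro t ht
    apply hfe
    rw [← ht, map_smul, map_smul, hskew, smul_zero]
  · intro j
    fin_cases j
    · exact hw
    · exact hhe

theorem stdMap_apply_gen {c : Fin n ⊕ Fin n} {w : V} (hw : cartan Q c w = w)
    (a b : Fin n ⊕ Fin n) (v : StdRep n) :
    stdMap Q c w ⁅spGen a b, v⁆ = Q a b (stdMap Q c w v) := by
  have : stdMap Q c w ∘ₗ (LieModule.toEnd ℝ (SpReal n) (StdRep n) (spGen a b)) =
      Q a b ∘ₗ stdMap Q c w := by
    refine (Pi.basisFun ℝ (Fin n ⊕ Fin n)).ext fun d => ?_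
    simp only [Pi.basisFun_apply, LinearMap.comp_apply, LieModule.toEnd_apply_apply,
      spGen_lie_single, map_add, map_smul, stdMap_single]
    rw [hQ.apply_eq_transfer hn hdim (hQ.cartan_transfer hn hdim hw d),
      hQ.transfer_transfer hn hdim hw, hQ.transfer_transfer hn hdim hw]
  exact LinearMap.congr_fun this v

theorem stdMap_sum_injective {κ : Type*} [Fintype κ] {c : Fin n ⊕ Fin n} {w : κ → V}
    (hli : LinearIndependent ℝ w) (hw : ∀ j, cartan Q c (w j) = w j) {f : κ → StdRep n}
    (hf : ∑ j, stdMap Q c (w j) (f j) = 0) : f = 0 := by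
  have key : ∀ b, ∑ j, f j b • w j = 0 := by
    intro b
    -- `H² + H` kills the eigenvalues `0` and `-1` and doubles eigenvalue `1`, so it isolates the
    -- component of weight `stdWeight b`.
    let P : Module.End ℝ V := cartan Q b * cartan Q b + cartan Q b
    have hP : ∀ a j, P (transfer Q a c (w j)) =
        if a = b then (2 : ℝ) • transfer Q b c (w j) else 0 := by
      intro a j
      have h := hQ.isWeightVec_stdWeight hn hdim (hQ.cartan_transfer hn hdim (hw j) a) b
      simp only [P, LinearMap.add_apply, Module.End.mul_apply, h, map_smul]
      rw [coordOf_stdWeight]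
      split_ifs with h1 h2
      · subst h1; simp only [Int.cast_one]; module
      · simp
      · simp
    have h1 := congrArg P hf
    simp only [map_sum, map_zero, stdMap, Fintype.linearCombination_apply, map_smul, hP,
      smul_ite, smul_zero, Finset.sum_ite_eq', Finset.mem_univ, if_true] at h1
    have h2 := congrArg (transfer Q c b) h1
    simp only [map_sum, map_smul, map_zero, hQ.transfer_transfer hn hdim (hw _)] at h2
    simp only [transfer, if_true, Module.End.one_apply, smul_comm _ (2 : ℝ),
      ← Finset.smul_sum] at h2
    exact (smul_eq_zero.1 h2).resolve_left (by norm_num)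
  funext j b
  exact Fintype.linearIndependent_iff.1 hli _ (key b) j

end IsSpSystem

end Embedding

/-! ### Passage to Lie modules, and the invariant form on two standard copies. -/

section Representations

variable {n : ℕ}

theorem isSpSystem_toEnd (V : Type*) [AddCommGroup V] [Module ℝ V] [LieRingModule (SpReal n) V]
    [LieModule ℝ (SpReal n) V] :
    IsSpSystem fun a b => LieModule.toEnd ℝ (SpReal n) V (spGen a b) where
  comm a b := by rw [spGen_comm]
  lie a b c d := by
    rw [← LieRing.of_associative_ring_bracket, ← LieHom.map_lie, spGen_lie]
    simp only [map_add, map_smul]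

theorem exists_injective_lieModuleHom (hn : 3 ≤ n) (V : Type*) [AddCommGroup V] [Module ℝ V]
    [LieRingModule (SpReal n) V] [LieModule ℝ (SpReal n) V] [FiniteDimensional ℝ V]
    (htriv : ¬ LieModule.IsTrivial (SpReal n) V) (hform : PreservesNondegSymmForm (SpReal n) V)
    (hdim : Module.finrank ℝ V ≤ 4 * n) :
    ∃ φ : (⨁ _ : Fin 2, StdRep n) →ₗ⁅ℝ, SpReal n⁆ V, Function.Injective φ := by
  have hQ := isSpSystem_toEnd (n := n) V
  obtain ⟨a, b, hab⟩ : ∃ a b, LieModule.toEnd ℝ (SpReal n) V (spGen a b) ≠ 0 := by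
    by_contra hno
    push Not at hno
    refine htriv ⟨fun x v => ?_⟩
    rw [← LieModule.toEnd_apply_apply ℝ, eq_sum_spGen x]
    simp [hno]
  obtain ⟨B, hsymm, hnd, hB⟩ := hform
  let i : Fin n := ⟨0, by omega⟩
  obtain ⟨w, hli, hw⟩ := hQ.exists_linearIndependent_pair hn hdim hab B hsymm hnd
    (fun a b v w => hB (spGen a b) v w) i
  have hequiv : ∀ j (x : SpReal n) (v : StdRep n),
      stdMap (fun a b => LieModule.toEnd ℝ (SpReal n) V (spGen a b)) (Sum.inl i) (w j) ⁅x, v⁆ =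
      ⁅x, stdMap (fun a b => LieModule.toEnd ℝ (SpReal n) V (spGen a b)) (Sum.inl i) (w j) v⁆ := by
    intro j x v
    rw [eq_sum_spGen x]
    simp only [sum_lie, smul_lie, map_sum, map_smul, hQ.stdMap_apply_gen hn hdim (hw j),
      LieModule.toEnd_apply_apply]
  let φ : (⨁ _ : Fin 2, StdRep n) →ₗ[ℝ] V := ∑ j,
    stdMap (fun a b => LieModule.toEnd ℝ (SpReal n) V (spGen a b)) (Sum.inl i) (w j) ∘ₗ
      DirectSum.component ℝ (Fin 2) (fun _ => StdRep n) j
  have hφ : ∀ f, φ f = ∑ j,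
      stdMap (fun a b => LieModule.toEnd ℝ (SpReal n) V (spGen a b)) (Sum.inl i) (w j) (f j) := by
    intro f
    simp only [φ, LinearMap.sum_apply, LinearMap.comp_apply]
    rfl
  refine ⟨{ φ with map_lie' := ?_ }, ?_⟩
  · intro x f
    change φ ⁅x, f⁆ = ⁅x, φ f⁆
    simp only [hφ, DirectSum.lie_module_bracket_apply, hequiv, lie_sum]
  · change Function.Injective φ
    rw [injective_iff_map_eq_zero]
    intro f hf
    rw [hφ] at hf
    have := hQ.stdMap_sum_injective hn hdim hli hw hf
    exact DFunLike.ext _ _ fun j => congrFun this j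

theorem finrank_directSum_stdRep (κ : Type*) [Fintype κ] :
    Module.finrank ℝ (⨁ _ : κ, StdRep n) = Fintype.card κ * (2 * n) := by
  rw [Module.finrank_directSum]
  simp [two_mul]

/-- The matrix of the standard symplectic form. -/
abbrev sympMatrix (n : ℕ) : Matrix (Fin n ⊕ Fin n) (Fin n ⊕ Fin n) ℝ :=
  Matrix.fromBlocks 0 1 (-1) 0

theorem toBilin'_sympMatrix_lie (x : SpReal n) (v w : StdRep n) :
    Matrix.toBilin' (sympMatrix n) ⁅x, v⁆ w + Matrix.toBilin' (sympMatrix n) v ⁅x, w⁆ = 0 := by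
  change Matrix.toBilin' (sympMatrix n) (x.1.mulVec v) w +
    Matrix.toBilin' (sympMatrix n) v (x.1.mulVec w) = 0
  rw [Matrix.toBilin'_apply', Matrix.toBilin'_apply', ← Matrix.vecMul_transpose,
    ← Matrix.dotProduct_mulVec, Matrix.mulVec_mulVec, Matrix.mulVec_mulVec, ← dotProduct_add,
    ← Matrix.add_mulVec, (mem_SpReal_iff n x.1).1 x.2]
  simp

theorem toBilin'_sympMatrix_swap (v w : StdRep n) :
    Matrix.toBilin' (sympMatrix n) v w = -Matrix.toBilin' (sympMatrix n) w v := by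
  have h : (sympMatrix n).transpose = -sympMatrix n := by
    simp [sympMatrix, Matrix.fromBlocks_transpose, Matrix.fromBlocks_neg]
  rw [Matrix.toBilin'_apply', Matrix.toBilin'_apply', Matrix.dotProduct_mulVec,
    ← Matrix.mulVec_transpose, h, dotProduct_comm]
  simp [Matrix.neg_mulVec]

theorem eq_zero_of_toBilin'_sympMatrix {v : StdRep n}
    (h : ∀ w, Matrix.toBilin' (sympMatrix n) v w = 0) : v = 0 := by
  have hJ : sympMatrix n * sympMatrix n = -1 := by
    simp [sympMatrix, Matrix.fromBlocks_multiply, ← Matrix.fromBlocks_one, Matrix.fromBlocks_neg]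
  have h1 := h ((sympMatrix n).mulVec v)
  rw [Matrix.toBilin'_apply', Matrix.mulVec_mulVec, hJ] at h1
  simpa [Matrix.neg_mulVec, dotProduct_self_eq_zero] using h1

/-- The form is the tensor product of the symplectic form with the alternating form on `ℝ²`; a
product of two skew forms is symmetric. -/
theorem preservesNondegSymmForm_directSum {κ : Type*} [DecidableEq κ] (e : Fin 2 ≃ κ) :
    PreservesNondegSymmForm (SpReal n) (⨁ _ : κ, StdRep n) := by
  let π : κ → (⨁ _ : κ, StdRep n) →ₗ[ℝ] StdRep n :=
    DirectSum.component ℝ κ (fun _ => StdRep n)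
  let B : LinearMap.BilinForm ℝ (⨁ _ : κ, StdRep n) :=
    (Matrix.toBilin' (sympMatrix n)).compl₁₂ (π (e 0)) (π (e 1)) -
      (Matrix.toBilin' (sympMatrix n)).compl₁₂ (π (e 1)) (π (e 0))
  have hB : ∀ f g, B f g = Matrix.toBilin' (sympMatrix n) (f (e 0)) (g (e 1)) -
      Matrix.toBilin' (sympMatrix n) (f (e 1)) (g (e 0)) := fun f g => rfl
  have hs : ∀ f g, B f g = B g f := by
    intro f g
    rw [hB, hB, toBilin'_sympMatrix_swap (f (e 0)), toBilin'_sympMatrix_swap (f (e 1))]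
    ring
  have hnd : ∀ f, (∀ g, B f g = 0) → f = 0 := by
    intro f hf
    have h0 : f (e 0) = 0 := by
      refine eq_zero_of_toBilin'_sympMatrix fun w => ?_
      have := hf (DirectSum.lof ℝ κ (fun _ => StdRep n) (e 1) w)
      rw [hB] at this
      have h1 : (DirectSum.lof ℝ κ (fun _ => StdRep n) (e 1) w) (e 1) = w :=
        DirectSum.lof_apply _ _ _
      have h2 : (DirectSum.lof ℝ κ (fun _ => StdRep n) (e 1) w) (e 0) = 0 :=
        DirectSum.of_eq_of_ne _ _ _ (by simp)
      rwa [h1, h2, (Matrix.toBilin' (sympMatrix n) (f (e 1))).map_zero, sub_zero] at this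
    have h1 : f (e 1) = 0 := by
      refine eq_zero_of_toBilin'_sympMatrix fun w => ?_
      have := hf (DirectSum.lof ℝ κ (fun _ => StdRep n) (e 0) w)
      rw [hB] at this
      have h1 : (DirectSum.lof ℝ κ (fun _ => StdRep n) (e 0) w) (e 0) = w :=
        DirectSum.lof_apply _ _ _
      have h2 : (DirectSum.lof ℝ κ (fun _ => StdRep n) (e 0) w) (e 1) = 0 :=
        DirectSum.of_eq_of_ne _ _ _ (by simp)
      rwa [h1, h2, (Matrix.toBilin' (sympMatrix n) (f (e 0))).map_zero, zero_sub,
        neg_eq_zero] at this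
    refine DFunLike.ext _ _ fun j => ?_
    obtain ⟨k, rfl⟩ := e.surjective j
    fin_cases k
    exacts [h0, h1]
  refine ⟨B, ⟨hs⟩, ⟨hnd, fun g hg => hnd g fun f => by rw [hs, hg]⟩, fun x f g => ?_⟩
  rw [hB, hB]
  simp only [DirectSum.lie_module_bracket_apply]
  have h1 := toBilin'_sympMatrix_lie x (f (e 0)) (g (e 1))
  have h2 := toBilin'_sympMatrix_lie x (f (e 1)) (g (e 0))
  linarith

theorem not_isTrivial_directSum (hn : 0 < n) {κ : Type*} [DecidableEq κ] (k : κ) :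
    ¬ LieModule.IsTrivial (SpReal n) (⨁ _ : κ, StdRep n) := by
  intro h
  let c : Fin n ⊕ Fin n := Sum.inl ⟨0, hn⟩
  have h1 := h.trivial (spGen c c.swap)
    (DirectSum.lof ℝ κ (fun _ => StdRep n) k (Pi.single c 1))
  have h2 := congrFun (DFunLike.congr_fun h1 k) c
  have h3 : (DirectSum.lof ℝ κ (fun _ => StdRep n) k (Pi.single c 1)) k = Pi.single c 1 :=
    DirectSum.lof_apply _ _ _
  rw [DirectSum.lie_module_bracket_apply, h3, spGen_lie_single] at h2
  have h4 : (0 : ⨁ _ : κ, StdRep n) k c = 0 := rfl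
  rw [h4] at h2
  simp [c, sympForm, sympSign] at h2

end Representations

theorem mainTheorem5 (n : ℕ) (hn : 3 ≤ n) :
    IsLeast {d : ℕ | ∃ (V : Type u) (_ : AddCommGroup V) (_ : Module ℝ V)
        (_ : LieRingModule (SpReal n) V) (_ : LieModule ℝ (SpReal n) V),
        FiniteDimensional ℝ V ∧ ¬ LieModule.IsTrivial (SpReal n) V ∧
        PreservesNondegSymmForm (SpReal n) V ∧ Module.finrank ℝ V = d} (4 * n) ∧
    ∀ (V : Type u) [AddCommGroup V] [Module ℝ V]
      [LieRingModule (SpReal n) V] [LieModule ℝ (SpReal n) V],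
      FiniteDimensional ℝ V → ¬ LieModule.IsTrivial (SpReal n) V →
      PreservesNondegSymmForm (SpReal n) V → Module.finrank ℝ V = 4 * n →
      Nonempty (V ≃ₗ⁅ℝ, SpReal n⁆ (⨁ _ : Fin 2, StdRep n)) := by
  have hfin : Module.finrank ℝ (⨁ _ : Fin 2, StdRep n) = 4 * n := by
    rw [finrank_directSum_stdRep, Fintype.card_fin]; ring
  -- Indexing by `ULift` places the example in the universe `u`.
  refine ⟨⟨⟨⨁ _ : ULift.{u} (Fin 2), StdRep n, inferInstance, inferInstance, inferInstance,
    inferInstance, inferInstance, not_isTrivial_directSum (by omega) (ULift.up 0),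
    preservesNondegSymmForm_directSum Equiv.ulift.symm, ?_⟩, ?_⟩, ?_⟩
  · rw [finrank_directSum_stdRep, Fintype.card_ulift, Fintype.card_fin]; ring
  · rintro d ⟨V, _, _, _, _, _, htriv, hform, rfl⟩
    by_contra hlt
    obtain ⟨φ, hφ⟩ := exists_injective_lieModuleHom hn V htriv hform (not_le.1 hlt).le
    have := LinearMap.finrank_le_finrank_of_injective (f := φ.toLinearMap) hφ
    omega
  · intro V _ _ _ _ _ htriv hform hdim
    obtain ⟨φ, hφ⟩ := exists_injective_lieModuleHom hn V htriv hform hdim.le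
    have hsurj : Function.Surjective φ :=
      (LinearMap.injective_iff_surjective_of_finrank_eq_finrank (f := φ.toLinearMap)
        (hfin.trans hdim.symm)).1 hφ
    let ψ := LinearEquiv.ofBijective φ.toLinearMap ⟨hφ, hsurj⟩
    exact ⟨LieModuleEquiv.symm
      { φ with invFun := ψ.symm, left_inv := ψ.left_inv, right_inv := ψ.right_inv }⟩
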